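/- Let $n\ge 1$, let $\mathbb B^n=\{z\in\mathbb C^n: |z|<1\}$, let $r(z)=|z|^2-1$, and let $d\mu$ be Lebesgue measure on $\mathbb B^n$ normalized to total mass one. For $m\in\mathbb N=\{0,1,2,\dots\}$ let $\mathcal H_m=A^2_m(\mathbb B^n)$ be the weighted Bergman space of holomorphic functions in $L^2(\mathbb B^n,(-r)^m d\mu)$, let $\Pi_m$ be the orthogonal projection of $L^2(\mathbb B^n,(-r)^m d\mu)$ onto $\mathcal H_m$, and let $T^{(m)}_f\phi=\Pi_m(f\phi)$ be the Toeplitz operator with symbol $f$. Put $\mathcal D_m=(T^{(m)}_{-r})^{-1}$ (with domain the range of $T^{(m)}_{-r}$) and $\alpha_m=m+1$, let $\mathcal A_m$ be the $*$-algebra of bounded operators generated by all $T^{(m)}_p$ with $p$ a polynomial in $z$ and $\bar z$, and let $\pi_m$ be the identity representation of $\mathcal A_m$ on $\mathcal H_m$. A (unital) spectral triple $(\mathcal A,\mathcal H,\mathcal D)$ consists of a unital $*$-algebra $\mathcal A$ represented faithfully by $\pi$ on a Hilbert space $\mathcal H$, and a selfadjoint operator $\mathcal D$ on $\mathcal H$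 with compact resolvent, such that for each $a\in\mathcal A$ the operator $\pi(a)$ maps $\operatorname{dom}\mathcal D$ into itself and $[\mathcal D,\pi(a)]$ extends to a bounded operator. Its spectral dimension is $\inf\{s\in\mathbb R:\operatorname{Tr}|\mathcal D|^{-s}<\infty\}$. Let $\mathcal H^\oplus=\bigoplus_m\mathcal H_m$ (Hilbert space sum), let $\mathcal D^\oplus=\bigoplus_m\alpha_m\mathcal D_m$ with domain the finite sums of vectors $v_m\in\operatorname{dom}\mathcal D_m$, let $\overline{\mathcal D^\oplus}$ be its closure, let $\mathcal A^\oplus$ be the set of sequences $(a_m)\in\prod_m\mathcal A_m$ with $\sup_m\|\pi_m(a_m)\|<\infty$ and $\sup_m\|[\alpha_m\mathcal D_m,\pi_m(a_m)]\|<\infty$, let $\pi^\oplus(a)=\bigoplus_m\pi_m(a_m)$, and let $\mathcal A'^\oplus$ be the algebra generated by the sequences $(T^{(m)}_p)_{m\in\mathbb N}$, with the same polynomial $p$ in $z$ and $\bar z$ at all levels. Then: 1. the family $(\mathcal A_m,\mathcal H_m,\mathcal D_m,\pi_m,\alpha_m)_{m\in\mathbb N}$ is integrable: every $(\mathcal A_m,\mathcal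 H_m,\mathcal D_m)$ is a spectral triple, every $\alpha_m$ is nonzero and $\|(1+\alpha_m^2\mathcal D_m^2)^{-1/2}\|\to 0$ as $m\to\infty$; moreover its integration $(\mathcal A^\oplus,\mathcal H^\oplus,\overline{\mathcal D^\oplus})$, with representation $\pi^\oplus$, is a spectral triple; 2. $\mathcal A'^\oplus$ is a $*$-subalgebra of $\mathcal A^\oplus$, and $(\mathcal A'^\oplus,\mathcal H^\oplus,\overline{\mathcal D^\oplus})$, with the restriction of $\pi^\oplus$, is a spectral triple of spectral dimension $n+1$. -/

import Mathlib

open MeasureTheory Filter Topology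
open scoped ENNReal

noncomputable section

namespace SpectralTriple

section Single

variable {H : Type*} [NormedAddCommGroup H] [InnerProductSpace ℂ H]

/-- `R` is the bounded everywhere defined operator `(D - z)⁻¹`. -/
def IsResolventAt (D : H →ₗ.[ℂ] H) (z : ℂ) (R : H →L[ℂ] H) : Prop :=
  (∀ x, ∃ h : R x ∈ D.domain, D ⟨R x, h⟩ - z • R x = x) ∧
    ∀ v : D.domain, R (D v - z • (v : H)) = v

/-- `a` maps the domain of `D` into itself and `B` is a bounded extension of `[D, a]`. -/
def IsCommutator (D : H →ₗ.[ℂ] H) (a B : H →L[ℂ] H) : Prop :=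
  ∀ v : D.domain, ∃ h : a v ∈ D.domain, D ⟨a v, h⟩ - a (D v) = B v

/-- `B = (1 + D²)^{-1/2}`: the operator `B` is positive and `B²` is the inverse of `1 + D²`. -/
def IsInvSqrtOneAddSq (D : H →ₗ.[ℂ] H) (B : H →L[ℂ] H) : Prop :=
  B.IsPositive ∧
    (∀ x, ∃ (h₁ : B (B x) ∈ D.domain) (h₂ : D ⟨B (B x), h₁⟩ ∈ D.domain),
      B (B x) + D ⟨D ⟨B (B x), h₁⟩, h₂⟩ = x) ∧
    ∀ (v : D.domain) (h : D v ∈ D.domain), B (B ((v : H) + D ⟨D v, h⟩)) = v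

variable [CompleteSpace H]

/-- Unital spectral triples `(A, H, D)`: `A` is a unital `*`-algebra represented faithfully on `H`
by `π`, and `D` is a selfadjoint operator on `H` with compact resolvent such that every `π a` maps
the domain of `D` into itself and `[D, π a]` extends to a bounded operator. -/
structure IsSpectralTriple {A : Type*} [Ring A] [StarRing A] [Algebra ℂ A]
    [StarModule ℂ A]
    (π : A →⋆ₐ[ℂ] (H →L[ℂ] H)) (D : H →ₗ.[ℂ] H) : Prop where
  faithful : Function.Injective π
  selfAdjoint : IsSelfAdjoint D
  compact_resolvent : ∀ z R, IsResolventAt D z R → IsCompactOperator R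
  commutator : ∀ a, ∃ B, IsCommutator D (π a) B

/-- The eigenspace of `D` for the real number `t`. -/
def eigenspace (D : H →ₗ.[ℂ] H) (t : ℝ) : Submodule ℂ H where
  carrier := {v | ∃ h : v ∈ D.domain, D ⟨v, h⟩ = (t : ℂ) • v}
  zero_mem' := ⟨D.domain.zero_mem, by
    rw [smul_zero]
    exact D.map_zero⟩
  add_mem' := by
    rintro v w ⟨hv, hv'⟩ ⟨hw, hw'⟩
    refine ⟨D.domain.add_mem hv hw, ?_⟩
    rw [smul_add, ← hv', ← hw', ← D.map_add]
    rfl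
  smul_mem' := by
    rintro c v ⟨hv, hv'⟩
    refine ⟨D.domain.smul_mem c hv, ?_⟩
    rw [smul_comm, ← hv', ← D.map_smul]
    rfl

/-- The spectral projection of `D` at the point `t`, i.e. the orthogonal projection onto the
eigenspace (which is already closed when `D` is a closed operator). -/
def eigenprojection (D : H →ₗ.[ℂ] H) (t : ℝ) : H →L[ℂ] H :=
  (eigenspace D t).topologicalClosure.starProjection

/-- The quadratic form `⟨v, |D|⁻ˢ v⟩ = ∑ₜ |t|⁻ˢ ‖Pₜ v‖² ∈ [0, ∞]` given by the functional calculus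
of a selfadjoint operator `D` with compact resolvent, whose spectral measure is the sum of its
eigenprojections `Pₜ`. -/
def absPowForm (D : H →ₗ.[ℂ] H) (s : ℝ) (v : H) : ℝ≥0∞ :=
  ∑' t : ℝ, ENNReal.ofReal |t| ^ (-s) * ‖eigenprojection D t v‖ₑ ^ 2

/-- The trace `Tr |D|⁻ˢ = ∑ᵢ ⟨eᵢ, |D|⁻ˢ eᵢ⟩ ∈ [0, ∞]` over an orthonormal Hilbert basis `(eᵢ)`
(it does not depend on the basis). -/
def traceAbsPow (D : H →ₗ.[ℂ] H) (s : ℝ) : ℝ≥0∞ :=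
  ∑' e : (exists_hilbertBasis ℂ H).choose, absPowForm D s (e : H)

/-- `d` is the spectral dimension `inf {s ∈ ℝ | Tr |D|⁻ˢ < ∞}` of `D`. -/
def IsSpectralDimension (D : H →ₗ.[ℂ] H) (d : ℝ) : Prop :=
  IsGLB {s : ℝ | traceAbsPow D s < ∞} d

end Single

section Sum

variable {H : ℕ → Type*} [∀ m, NormedAddCommGroup (H m)] [∀ m, InnerProductSpace ℂ (H m)]

/-- The Hilbert space direct sum of the spaces `H m`. -/
abbrev HilbertSum (H : ℕ → Type*) [∀ m, NormedAddCommGroup (H m)] : Type _ :=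
  lp H 2

/-- The operator `⊕ₘ αₘ Dₘ` with domain the finite sums of vectors `vₘ ∈ dom Dₘ`. -/
def sumOp (D : ∀ m, H m →ₗ.[ℂ] H m) (α : ℕ → ℝ) : HilbertSum H →ₗ.[ℂ] HilbertSum H where
  domain :=
    { carrier := {v | (∃ N : ℕ, ∀ m, N < m → v m = 0) ∧ ∀ m, v m ∈ (D m).domain}
      zero_mem' := ⟨⟨0, fun _ _ => rfl⟩, fun m => (D m).domain.zero_mem⟩
      add_mem' := by
        rintro v w ⟨⟨N, hN⟩, hv⟩ ⟨⟨N', hN'⟩, hw⟩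
        refine ⟨⟨max N N', fun m hm => ?_⟩, fun m => (D m).domain.add_mem (hv m) (hw m)⟩
        rw [lp.coeFn_add, Pi.add_apply, hN m (lt_of_le_of_lt (le_max_left _ _) hm),
          hN' m (lt_of_le_of_lt (le_max_right _ _) hm), add_zero]
      smul_mem' := by
        rintro c v ⟨⟨N, hN⟩, hv⟩
        refine ⟨⟨N, fun m hm => ?_⟩, fun m => (D m).domain.smul_mem c (hv m)⟩
        rw [lp.coeFn_smul, Pi.smul_apply, hN m hm, smul_zero] }
  toFun :=
    { toFun := fun v => ⟨fun m => (α m : ℂ) • D m ⟨v.1 m, v.2.2 m⟩, by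
        obtain ⟨N, hN⟩ := v.2.1
        refine (memℓp_zero ((Set.finite_Iic N).subset fun m hm => ?_)).of_exponent_ge zero_le
        by_contra hlt
        refine hm ?_
        have h0 : (⟨v.1 m, v.2.2 m⟩ : (D m).domain) = 0 :=
          Subtype.ext (hN m (not_le.1 hlt))
        rw [h0, (D m).map_zero, smul_zero]⟩
      map_add' := fun v w => by
        ext m
        change (α m : ℂ) • D m (⟨v.1 m, v.2.2 m⟩ + ⟨w.1 m, w.2.2 m⟩) = _ • _ + _ • _
        rw [(D m).map_add, smul_add]
      map_smul' := fun c v => by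
        ext m
        change (α m : ℂ) • D m (c • ⟨v.1 m, v.2.2 m⟩) = c • (_ • _)
        rw [(D m).map_smul, smul_comm] }

/-- The diagonal operator `⊕ₘ Tₘ` of a bounded sequence of bounded operators. -/
def diagOp (T : ∀ m, H m →L[ℂ] H m) (hT : ∃ C : ℝ, ∀ m, ‖T m‖ ≤ C) :
    HilbertSum H →L[ℂ] HilbertSum H :=
  lp.mapCLM 2 T ((norm_nonneg _).trans (hT.choose_spec 0)) hT.choose_spec

theorem diagOp_apply (T : ∀ m, H m →L[ℂ] H m) (hT : ∃ C : ℝ, ∀ m, ‖T m‖ ≤ C)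
    (v : HilbertSum H) (m : ℕ) : diagOp T hT v m = T m (v m) := rfl

variable [∀ m, CompleteSpace (H m)] {A : ℕ → Type*} [∀ m, Ring (A m)] [∀ m, StarRing (A m)]
  [∀ m, Algebra ℂ (A m)] [∀ m, StarModule ℂ (A m)]

/-- The quintuple `(Aₘ, Hₘ, Dₘ, πₘ, αₘ)ₘ` is integrable: each `(Aₘ, Hₘ, Dₘ)` is a spectral triple,
the weights are nonzero and `‖(1 + αₘ² Dₘ²)^{-1/2}‖ → 0`. -/
structure IsIntegrable (π : ∀ m, A m →⋆ₐ[ℂ] (H m →L[ℂ] H m)) (D : ∀ m, H m →ₗ.[ℂ] H m)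
    (α : ℕ → ℝ) : Prop where
  spectralTriple : ∀ m, IsSpectralTriple (π m) (D m)
  weight_ne_zero : ∀ m, α m ≠ 0
  tendsto_zero : ∃ B : ∀ m, H m →L[ℂ] H m,
    (∀ m, IsInvSqrtOneAddSq ((α m : ℂ) • D m) (B m)) ∧ Tendsto (fun m => ‖B m‖) atTop (𝓝 0)

variable {π : ∀ m, A m →⋆ₐ[ℂ] (H m →L[ℂ] H m)} {D : ∀ m, H m →ₗ.[ℂ] H m} {α : ℕ → ℝ}

/-- Commutators with an adjoint. -/
theorem isCommutator_star {K : Type*} [NormedAddCommGroup K] [InnerProductSpace ℂ K]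
    [CompleteSpace K] {T : K →ₗ.[ℂ] K} (hT : IsSelfAdjoint T) (c : ℝ) {a B : K →L[ℂ] K}
    (h : IsCommutator ((c : ℂ) • T) a B) (hd : ∀ v : T.domain, (star a) v ∈ T.domain) :
    IsCommutator ((c : ℂ) • T) (star a) (-star B) := by
  have hsym : ∀ v w : T.domain, inner ℂ (T v) (w : K) = inner ℂ (v : K) (T w) := by
    have := LinearPMap.adjoint_isFormalAdjoint hT.dense_domain
    rw [LinearPMap.isSelfAdjoint_def.1 hT] at this
    exact fun v w => this v w
  intro v
  refine ⟨hd v, ?_⟩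
  refine hT.dense_domain.eq_of_inner_left (𝕜 := ℂ) fun w hw => ?_
  obtain ⟨h1, h2⟩ := h ⟨w, hw⟩
  have e1 : inner ℂ (T ⟨star a v, hd v⟩) w = inner ℂ (v : K) (a (T ⟨w, hw⟩)) := by
    exact (hsym ⟨star a v, hd v⟩ ⟨w, hw⟩).trans (ContinuousLinearMap.adjoint_inner_left _ _ _)
  have e2 : inner ℂ (star a (T v)) w = inner ℂ (v : K) (T ⟨a w, h1⟩) := by
    rw [ContinuousLinearMap.star_eq_adjoint, ContinuousLinearMap.adjoint_inner_left]
    exact hsym v ⟨a w, h1⟩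
  have e3 : inner ℂ ((-star B) (v : K)) w = -inner ℂ (v : K) (B w) := by
    rw [neg_apply, inner_neg_left, ContinuousLinearMap.star_eq_adjoint,
      ContinuousLinearMap.adjoint_inner_left]
  rw [e3, ← h2]
  change inner ℂ ((c : ℂ) • T ⟨star a v, hd v⟩ - star a ((c : ℂ) • T v)) w
    = -inner ℂ (v : K) ((c : ℂ) • T ⟨a w, h1⟩ - a ((c : ℂ) • T ⟨w, hw⟩))
  simp only [map_smul, ← smul_sub, inner_smul_left, inner_smul_right, inner_sub_left,
    inner_sub_right, e1, e2, Complex.conj_ofReal]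
  ring

/-- The `*`-algebra of the integrated triple: the sequences `(aₘ)` with `sup ‖πₘ(aₘ)‖ < ∞` and
`sup ‖[αₘ Dₘ, πₘ(aₘ)]‖ < ∞`. -/
def sumAlgebra (h : IsIntegrable π D α) : StarSubalgebra ℂ (∀ m, A m) where
  carrier := {a | (∃ C : ℝ, ∀ m, ‖π m (a m)‖ ≤ C) ∧
    ∃ C : ℝ, ∀ m, ∃ B, IsCommutator ((α m : ℂ) • D m) (π m (a m)) B ∧ ‖B‖ ≤ C}
  mul_mem' := by
    rintro a b ⟨⟨C₁, h₁⟩, C₂, h₂⟩ ⟨⟨C₃, h₃⟩, C₄, h₄⟩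
    choose B hB hBn using h₂
    choose B' hB' hBn' using h₄
    have hC₁ : 0 ≤ C₁ := (norm_nonneg _).trans (h₁ 0)
    have hC₂ : 0 ≤ C₂ := (norm_nonneg _).trans (hBn 0)
    refine ⟨⟨C₁ * C₃, fun m => ?_⟩, C₂ * C₃ + C₁ * C₄, fun m =>
      ⟨B m * π m (b m) + π m (a m) * B' m, fun v => ?_, ?_⟩⟩
    · rw [Pi.mul_apply, map_mul]
      exact (norm_mul_le _ _).trans
        (mul_le_mul (h₁ m) (h₃ m) (norm_nonneg _) hC₁)
    · obtain ⟨k₁, e₁⟩ := hB' m v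
      obtain ⟨k₂, e₂⟩ := hB m ⟨_, k₁⟩
      rw [Pi.mul_apply, map_mul]
      refine ⟨k₂, ?_⟩
      simp only [add_apply, mul_apply_eq_comp, ← e₁, ← e₂, map_sub]
      abel_nf
    · exact (norm_add_le _ _).trans (add_le_add
        ((norm_mul_le _ _).trans (mul_le_mul (hBn m) (h₃ m) (norm_nonneg _) hC₂))
        ((norm_mul_le _ _).trans (mul_le_mul (h₁ m) (hBn' m) (norm_nonneg _) hC₁)))
  add_mem' := by
    rintro a b ⟨⟨C₁, h₁⟩, C₂, h₂⟩ ⟨⟨C₃, h₃⟩, C₄, h₄⟩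
    choose B hB hBn using h₂
    choose B' hB' hBn' using h₄
    refine ⟨⟨C₁ + C₃, fun m => ?_⟩, C₂ + C₄, fun m => ⟨B m + B' m, fun v => ?_, ?_⟩⟩
    · rw [Pi.add_apply, map_add]
      exact (norm_add_le _ _).trans (add_le_add (h₁ m) (h₃ m))
    · obtain ⟨k₁, e₁⟩ := hB m v
      obtain ⟨k₂, e₂⟩ := hB' m v
      rw [Pi.add_apply, map_add]
      refine ⟨((α m : ℂ) • D m).domain.add_mem k₁ k₂, ?_⟩
      rw [add_apply (B m), ← e₁, ← e₂, ← add_sub_add_comm, ← LinearPMap.map_add]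
      rfl
    · exact (norm_add_le _ _).trans (add_le_add (hBn m) (hBn' m))
  algebraMap_mem' := by
    intro c
    refine ⟨⟨‖c‖, fun m => ?_⟩, 0, fun m => ⟨0, fun v => ?_, by simp⟩⟩
    · rw [Pi.algebraMap_apply, AlgHomClass.commutes, Algebra.algebraMap_eq_smul_one]
      refine ContinuousLinearMap.opNorm_le_bound _ (norm_nonneg _) fun x => ?_
      simp [norm_smul]
    · rw [Pi.algebraMap_apply, AlgHomClass.commutes, Algebra.algebraMap_eq_smul_one]
      refine ⟨((α m : ℂ) • D m).domain.smul_mem c v.2, ?_⟩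
      rw [sub_eq_zero.2]
      · rfl
      · exact ((α m : ℂ) • D m).map_smul c v
  star_mem' := by
    rintro a ⟨⟨C₁, h₁⟩, C₂, h₂⟩
    refine ⟨⟨C₁, fun m => ?_⟩, C₂, fun m => ?_⟩
    · rw [Pi.star_apply, map_star, norm_star]
      exact h₁ m
    · obtain ⟨B, hB, hBn⟩ := h₂ m
      rw [Pi.star_apply, map_star]
      refine ⟨-star B, isCommutator_star (h.spectralTriple m).selfAdjoint (α m) hB fun v => ?_, ?_⟩
      · obtain ⟨B', hB'⟩ := (h.spectralTriple m).commutator (star (a m))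
        rw [map_star] at hB'
        exact (hB' v).1
      · rw [norm_neg, norm_star]
        exact hBn

/-- The representation `π(a) = ⊕ₘ πₘ(aₘ)` of the integrated triple. -/
def sumRep (h : IsIntegrable π D α) :
    sumAlgebra h →⋆ₐ[ℂ] (HilbertSum H →L[ℂ] HilbertSum H) where
  toFun a := diagOp (fun m => π m (a.1 m)) a.2.1
  map_one' := by
    ext v m
    simp [diagOp_apply]
  map_mul' a b := by
    ext v m
    simp [diagOp_apply]
  map_zero' := by
    ext v m
    simp [diagOp_apply]
  map_add' a b := by
    ext v m
    simp [diagOp_apply]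
  commutes' c := by
    ext v m
    simp [diagOp_apply, Algebra.algebraMap_eq_smul_one]
  map_star' a := by
    rw [ContinuousLinearMap.star_eq_adjoint, ContinuousLinearMap.eq_adjoint_iff]
    intro v w
    rw [lp.inner_eq_tsum, lp.inner_eq_tsum]
    refine tsum_congr fun m => ?_
    simp [diagOp_apply, map_star, ContinuousLinearMap.star_eq_adjoint,
      ContinuousLinearMap.adjoint_inner_left]

/-- The restriction of the representation `⊕ₘ πₘ` to a `*`-subalgebra. -/
def subRep (h : IsIntegrable π D α) {S : StarSubalgebra ℂ (∀ m, A m)} (hS : S ≤ sumAlgebra h) :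
    S →⋆ₐ[ℂ] (HilbertSum H →L[ℂ] HilbertSum H) :=
  (sumRep h).comp (StarSubalgebra.inclusion hS)

end Sum

end SpectralTriple

namespace BergmanTriple

/-- Complex Euclidean space `ℂⁿ` with its Hermitian norm. -/
abbrev Cn (n : ℕ) : Type := EuclideanSpace ℂ (Fin n)

/-- The open unit ball of `ℂⁿ`. -/
def unitBall (n : ℕ) : Set (Cn n) := Metric.ball 0 1

/-- The defining function `r(z) = |z|² - 1` of the unit ball. -/
def defFun (n : ℕ) : C(Cn n, ℂ) where
  toFun z := ((‖z‖ ^ 2 - 1 : ℝ) : ℂ)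
  continuous_toFun := by fun_prop

/-- Lebesgue measure on the unit ball, normalized to total mass one. -/
def ballMeasure (n : ℕ) : Measure (Cn n) :=
  (volume (unitBall n))⁻¹ • volume.restrict (unitBall n)

/-- The weighted measure `(-r)ᵐ dμ = (1 - |z|²)ᵐ dμ` on the unit ball. -/
def weightedMeasure (n m : ℕ) : Measure (Cn n) :=
  (ballMeasure n).withDensity fun z => ENNReal.ofReal ((1 - ‖z‖ ^ 2) ^ m)

theorem volume_unitBall_ne_zero (n : ℕ) : volume (unitBall n) ≠ 0 :=
  (Metric.isOpen_ball.measure_pos volume ⟨0, by simp⟩).ne'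

theorem volume_unitBall_ne_top (n : ℕ) : volume (unitBall n) ≠ ∞ :=
  measure_ball_lt_top.ne

theorem weightedMeasure_ac (n m : ℕ) :
    weightedMeasure n m ≪ volume.restrict (unitBall n) :=
  (withDensity_absolutelyContinuous _ _).trans Measure.smul_absolutelyContinuous

theorem ae_mem_unitBall (n m : ℕ) : ∀ᵐ z ∂weightedMeasure n m, z ∈ unitBall n :=
  (weightedMeasure_ac n m).ae_le (ae_restrict_mem Metric.isOpen_ball.measurableSet)

instance isFiniteMeasure_weightedMeasure (n m : ℕ) : IsFiniteMeasure (weightedMeasure n m) := by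
  refine ⟨?_⟩
  rw [weightedMeasure, withDensity_apply _ MeasurableSet.univ, Measure.restrict_univ, ballMeasure,
    lintegral_smul_measure]
  have h : ∫⁻ z in unitBall n, ENNReal.ofReal ((1 - ‖z‖ ^ 2) ^ m) ≤ volume (unitBall n) := by
    calc _ ≤ ∫⁻ z in unitBall n, 1 := by
          refine setLIntegral_mono_ae' Metric.isOpen_ball.measurableSet (.of_forall fun z hz => ?_)
          have hz' : ‖z‖ < 1 := by simpa [unitBall] using hz
          have h0 := norm_nonneg z
          rw [← ENNReal.ofReal_one]
          exact ENNReal.ofReal_le_ofReal (pow_le_one₀ (by nlinarith) (by nlinarith))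
      _ = _ := by simp
  exact ENNReal.mul_lt_top (ENNReal.inv_lt_top.2 (pos_iff_ne_zero.2 (volume_unitBall_ne_zero n)))
    (h.trans_lt (volume_unitBall_ne_top n).lt_top)

/-- On a smaller ball, Lebesgue measure is controlled by the weighted measure. -/
theorem exists_restrict_le (n m : ℕ) {s : ℝ} (hs : s < 1) :
    ∃ C : ℝ≥0∞, C ≠ ∞ ∧
      volume.restrict (Metric.ball (0 : Cn n) s) ≤ C • weightedMeasure n m := by
  rcases le_or_gt s 0 with h0 | h0
  · exact ⟨0, by simp, by simp [Metric.ball_eq_empty.2 h0]⟩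
  set c : ℝ≥0∞ := ENNReal.ofReal ((1 - s ^ 2) ^ m) with hc
  have hpos : (0 : ℝ) < (1 - s ^ 2) ^ m := pow_pos (by nlinarith) m
  have hc0 : c ≠ 0 := (ENNReal.ofReal_pos.2 hpos).ne'
  set V := volume (unitBall n)
  refine ⟨c⁻¹ * V, ENNReal.mul_ne_top (ENNReal.inv_ne_top.2 hc0) (volume_unitBall_ne_top n), ?_⟩
  refine Measure.le_iff.2 fun A hA => ?_
  rw [Measure.smul_apply, smul_eq_mul, weightedMeasure, withDensity_apply _ hA, ballMeasure,
    Measure.restrict_smul, lintegral_smul_measure, Measure.restrict_restrict hA, smul_eq_mul,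
    ← mul_assoc, mul_assoc c⁻¹, ENNReal.mul_inv_cancel (volume_unitBall_ne_zero n)
      (volume_unitBall_ne_top n), mul_one, Measure.restrict_apply hA]
  rw [← ENNReal.div_eq_inv_mul, ENNReal.le_div_iff_mul_le (.inl hc0) (.inl ENNReal.ofReal_ne_top)]
  calc volume (A ∩ Metric.ball 0 s) * c = ∫⁻ _ in A ∩ Metric.ball 0 s, c := by
        rw [setLIntegral_const, mul_comm]
    _ ≤ ∫⁻ z in A ∩ Metric.ball 0 s, ENNReal.ofReal ((1 - ‖z‖ ^ 2) ^ m) := by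
        refine setLIntegral_mono_ae' (hA.inter Metric.isOpen_ball.measurableSet)
          (.of_forall fun z hz => ENNReal.ofReal_le_ofReal ?_)
        have hz' : ‖z‖ < s := by simpa using hz.2
        have := norm_nonneg z
        exact pow_le_pow_left₀ (by nlinarith) (by nlinarith) m
    _ ≤ _ := lintegral_mono_set
        (Set.inter_subset_inter_right _ (Metric.ball_subset_ball hs.le))

/-- Sub-mean value inequality over balls. -/
theorem enorm_mul_volume_ball_le {n : ℕ} {F : Cn n → ℂ} {z : Cn n} {ρ : ℝ}
    (hF : DifferentiableOn ℂ F (Metric.ball z ρ)) :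
    ‖F z‖ₑ * volume (Metric.ball z ρ) ≤ ∫⁻ w in Metric.ball z ρ, ‖F w‖ₑ := by
  let rot : ℝ → (Cn n ≃ₗᵢ[ℝ] Cn n) := fun θ =>
    { toFun := fun u => circleMap 0 1 θ • u
      map_add' := fun u v => smul_add _ u v
      map_smul' := fun c u => smul_comm _ c u
      invFun := fun u => (circleMap 0 1 θ)⁻¹ • u
      left_inv := fun u => inv_smul_smul₀ (circleMap_ne_center one_ne_zero) u
      right_inv := fun u => smul_inv_smul₀ (circleMap_ne_center one_ne_zero) u
      norm_map' := fun u => by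
        change ‖circleMap 0 1 θ • u‖ = ‖u‖
        simp [norm_smul] }
  set g : Cn n → ℝ≥0∞ := (Metric.ball (0 : Cn n) ρ).indicator fun u => ‖F (z + u)‖ₑ with hg
  have hmaps : Set.MapsTo (fun u : Cn n => z + u) (Metric.ball 0 ρ) (Metric.ball z ρ) :=
    fun u hu => by simpa [dist_eq_norm] using hu
  have hcont : ContinuousOn (fun u : Cn n => F (z + u)) (Metric.ball 0 ρ) :=
    hF.continuousOn.comp (by fun_prop) hmaps
  have hgm : Measurable g := by
    classical
    rw [hg, ← Set.piecewise_eq_indicator]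
    exact hcont.enorm.measurable_piecewise continuousOn_const Metric.isOpen_ball.measurableSet
  have hpi : ENNReal.ofReal (2 * Real.pi) ≠ 0 := (ENNReal.ofReal_pos.2 Real.two_pi_pos).ne'
  have hI : ∫⁻ w in Metric.ball z ρ, ‖F w‖ₑ = ∫⁻ u, g u := by
    rw [hg, lintegral_indicator Metric.isOpen_ball.measurableSet,
      ← lintegral_indicator Metric.isOpen_ball.measurableSet,
      ← lintegral_indicator Metric.isOpen_ball.measurableSet,
      ← lintegral_add_left_eq_self _ z]
    refine lintegral_congr fun u => ?_
    simp [Set.indicator, dist_eq_norm]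
  have hrot : ∀ θ, ∫⁻ u, g (rot θ u) = ∫⁻ u, g u := fun θ =>
    (rot θ).measurePreserving.lintegral_comp hgm
  have key : ∀ u ∈ Metric.ball (0 : Cn n) ρ,
      ENNReal.ofReal (2 * Real.pi) * ‖F z‖ₑ
        ≤ ∫⁻ θ in Set.Ioc 0 (2 * Real.pi), g (rot θ u) := by
    intro u hu
    have hu' : ‖u‖ < ρ := by simpa using hu
    have hh : DiffContOnCl ℂ (fun ζ : ℂ => F (z + ζ • u)) (Metric.ball 0 |1|) := by
      refine DifferentiableOn.diffContOnCl ?_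
      refine hF.comp (by fun_prop) fun ζ hζ => ?_
      have hζ' : ‖ζ‖ ≤ 1 := by
        have := Metric.closure_ball_subset_closedBall hζ
        simpa using this
      simp only [Metric.mem_ball, dist_eq_norm, add_sub_cancel_left, norm_smul]
      nlinarith [norm_nonneg u]
    have h1 := hh.circleAverage
    rw [Real.circleAverage, intervalIntegral.integral_of_le Real.two_pi_pos.le] at h1
    simp only [zero_smul, add_zero] at h1
    have h2 : ENNReal.ofReal (2 * Real.pi) * ‖F z‖ₑ
        = ‖∫ θ in Set.Ioc 0 (2 * Real.pi), F (z + circleMap 0 1 θ • u)‖ₑ := by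
      rw [← h1, enorm_smul, ← mul_assoc, ← Real.enorm_of_nonneg Real.two_pi_pos.le, ← enorm_mul,
        mul_inv_cancel₀ Real.two_pi_pos.ne', enorm_one, one_mul]
    rw [h2]
    refine (enorm_integral_le_lintegral_enorm _).trans (le_of_eq (lintegral_congr fun θ => ?_))
    have hmem : rot θ u ∈ Metric.ball (0 : Cn n) ρ := by simpa using hu'
    rw [hg, Set.indicator_of_mem hmem]
    rfl
  have hswap : ENNReal.ofReal (2 * Real.pi) * ∫⁻ u, g u
      = ∫⁻ u, ∫⁻ θ in Set.Ioc 0 (2 * Real.pi), g (rot θ u) := by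
    rw [lintegral_lintegral_swap]
    · simp only [hrot, lintegral_const, Measure.restrict_apply_univ, Real.volume_Ioc, sub_zero]
      rw [mul_comm]
    · refine (hgm.comp ?_).aemeasurable
      have : Continuous fun p : Cn n × ℝ => circleMap 0 1 p.2 • p.1 := by fun_prop
      exact this.measurable
  rw [hI]
  refine (ENNReal.mul_le_mul_iff_right hpi ENNReal.ofReal_ne_top).1 ?_
  rw [hswap]
  calc ENNReal.ofReal (2 * Real.pi) * (‖F z‖ₑ * volume (Metric.ball z ρ))
      = ∫⁻ _ in Metric.ball (0 : Cn n) ρ, ENNReal.ofReal (2 * Real.pi) * ‖F z‖ₑ := by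
        rw [setLIntegral_const, Measure.addHaar_ball_center, mul_assoc]
    _ ≤ ∫⁻ u in Metric.ball (0 : Cn n) ρ,
          ∫⁻ θ in Set.Ioc 0 (2 * Real.pi), g (rot θ u) :=
        setLIntegral_mono_ae' Metric.isOpen_ball.measurableSet (.of_forall key)
    _ ≤ _ := setLIntegral_le_lintegral _ _

theorem aestronglyMeasurable_of_holomorphic {n : ℕ} (m : ℕ) {F : Cn n → ℂ}
    (hF : DifferentiableOn ℂ F (unitBall n)) :
    AEStronglyMeasurable F (weightedMeasure n m) :=
  (hF.continuousOn.aestronglyMeasurable Metric.isOpen_ball.measurableSet).mono_ac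
    (weightedMeasure_ac n m)

/-- Point evaluations are locally uniformly bounded on square integrable holomorphic functions. -/
theorem exists_pointwise_bound {n : ℕ} (m : ℕ) {z₀ : Cn n} (hz₀ : z₀ ∈ unitBall n) :
    ∃ ρ : ℝ, 0 < ρ ∧ Metric.ball z₀ ρ ⊆ unitBall n ∧ ∃ K : ℝ≥0∞, K ≠ ∞ ∧
      ∀ F : Cn n → ℂ, DifferentiableOn ℂ F (unitBall n) →
        ∀ z ∈ Metric.ball z₀ ρ, ‖F z‖ₑ ≤ K * eLpNorm F 2 (weightedMeasure n m) := by
  have hz : ‖z₀‖ < 1 := by simpa [unitBall] using hz₀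
  set ρ : ℝ := (1 - ‖z₀‖) / 4 with hρ
  have hρ0 : 0 < ρ := by linarith
  have hs : ‖z₀‖ + 2 * ρ < 1 := by linarith
  have hsub : ∀ z ∈ Metric.ball z₀ ρ, Metric.ball z ρ ⊆ Metric.ball 0 (‖z₀‖ + 2 * ρ) := by
    intro z hz
    refine Metric.ball_subset_ball' ?_
    have h1 : dist z z₀ < ρ := hz
    have h2 := dist_triangle z z₀ 0
    rw [dist_zero_right z₀] at h2
    linarith
  obtain ⟨C, hC, hCle⟩ := exists_restrict_le n m hs
  set v := volume (Metric.ball (0 : Cn n) ρ) with hv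
  have hv0 : v ≠ 0 := (Metric.isOpen_ball.measure_pos volume ⟨0, by simpa using hρ0⟩).ne'
  have hvt : v ≠ ∞ := measure_ball_lt_top.ne
  set M := weightedMeasure n m Set.univ ^ (1 / (1 : ℝ≥0∞).toReal - 1 / (2 : ℝ≥0∞).toReal) with hM
  have hMt : M ≠ ∞ := ENNReal.rpow_ne_top_of_nonneg (by norm_num) (measure_ne_top _ _)
  refine ⟨ρ, hρ0, fun z hz => ?_, v⁻¹ * (C * M),
    ENNReal.mul_ne_top (ENNReal.inv_ne_top.2 hv0) (ENNReal.mul_ne_top hC hMt), ?_⟩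
  · exact Metric.ball_subset_ball hs.le (hsub z hz (Metric.mem_ball_self hρ0))
  intro F hF z hz
  have h1 := enorm_mul_volume_ball_le
    (hF.mono ((hsub z hz).trans (Metric.ball_subset_ball hs.le)))
  rw [Measure.addHaar_ball_center, ← hv] at h1
  have h2 : ∫⁻ w in Metric.ball z ρ, ‖F w‖ₑ ≤ C * (eLpNorm F 2 (weightedMeasure n m) * M) := by
    calc ∫⁻ w in Metric.ball z ρ, ‖F w‖ₑ
        ≤ ∫⁻ w in Metric.ball (0 : Cn n) (‖z₀‖ + 2 * ρ), ‖F w‖ₑ := lintegral_mono_set (hsub z hz)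
      _ ≤ ∫⁻ w, ‖F w‖ₑ ∂(C • weightedMeasure n m) := lintegral_mono' hCle le_rfl
      _ = C * eLpNorm F 1 (weightedMeasure n m) := by
          rw [lintegral_smul_measure, eLpNorm_one_eq_lintegral_enorm, smul_eq_mul]
      _ ≤ _ := by
          gcongr
          exact eLpNorm_le_eLpNorm_mul_rpow_measure_univ (by norm_num)
            (aestronglyMeasurable_of_holomorphic m hF)
  calc ‖F z‖ₑ = v⁻¹ * (‖F z‖ₑ * v) := by
        rw [mul_comm ‖F z‖ₑ, ← mul_assoc, ENNReal.inv_mul_cancel hv0 hvt, one_mul]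
    _ ≤ v⁻¹ * (C * (eLpNorm F 2 (weightedMeasure n m) * M)) := by
        exact mul_le_mul_right (h1.trans h2) _
    _ = _ := by ring

/-- A locally uniform limit of holomorphic functions is holomorphic. -/
theorem differentiableAt_of_uniformCauchySeqOn {n : ℕ} {f : ℕ → Cn n → ℂ} {F : Cn n → ℂ}
    {z₀ : Cn n} {R : ℝ} (hR : 0 < R) (hf : ∀ k, DifferentiableOn ℂ (f k) (Metric.ball z₀ R))
    (hc : UniformCauchySeqOn f atTop (Metric.ball z₀ R))
    (hl : ∀ z ∈ Metric.ball z₀ R, Tendsto (fun k => f k z) atTop (𝓝 (F z))) :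
    DifferentiableAt ℂ F z₀ := by
  have hsub : ∀ z ∈ Metric.ball z₀ (R / 2), Metric.ball z (R / 2) ⊆ Metric.ball z₀ R := by
    intro z hz
    refine Metric.ball_subset_ball' ?_
    have : dist z z₀ < R / 2 := hz
    linarith
  have hsub' : Metric.ball z₀ (R / 2) ⊆ Metric.ball z₀ R := Metric.ball_subset_ball (by linarith)
  have hd : ∀ k, ∀ z ∈ Metric.ball z₀ (R / 2), DifferentiableAt ℂ (f k) z := fun k z hz =>
    (hf k).differentiableAt (Metric.isOpen_ball.mem_nhds (hsub' hz))
  have hc' : UniformCauchySeqOn (fun k => fderiv ℂ (f k)) atTop (Metric.ball z₀ (R / 2)) := by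
    rw [Metric.uniformCauchySeqOn_iff] at hc ⊢
    intro ε hε
    obtain ⟨N, hN⟩ := hc (ε * R / 8) (by positivity)
    refine ⟨N, fun k hk l hl z hz => ?_⟩
    have h1 : ‖fderiv ℂ (fun w => f k w - f l w) z‖ ≤ (2 * (ε * R / 8)) / (R / 2) := by
      refine Complex.norm_fderiv_le_div_of_mapsTo_ball
        (((hf k).sub (hf l)).mono (hsub z hz)) (fun w hw => ?_) (by linarith)
      have hw1 := hN k hk l hl w (hsub z hz hw)
      have hw2 := hN k hk l hl z (hsub' hz)
      rw [dist_eq_norm] at hw1 hw2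
      rw [Metric.mem_closedBall, dist_eq_norm]
      exact (norm_sub_le _ _).trans (by linarith)
    rw [fderiv_fun_sub (hd k z hz) (hd l z hz)] at h1
    rw [dist_eq_norm]
    refine h1.trans_lt ?_
    have : (2 * (ε * R / 8)) / (R / 2) = ε / 2 := by field_simp; ring
    linarith
  have hex : ∀ z, ∃ L : Cn n →L[ℂ] ℂ, z ∈ Metric.ball z₀ (R / 2) →
      Tendsto (fun k => fderiv ℂ (f k) z) atTop (𝓝 L) := by
    intro z
    by_cases hz : z ∈ Metric.ball z₀ (R / 2)
    · obtain ⟨L, hL⟩ := cauchySeq_tendsto_of_complete (hc'.cauchySeq hz)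
      exact ⟨L, fun _ => hL⟩
    · exact ⟨0, fun h => absurd h hz⟩
  choose g' hg' using hex
  exact (hasFDerivAt_of_tendstoUniformlyOn Metric.isOpen_ball
    (hc'.tendstoUniformlyOn_of_tendsto fun z hz => hg' z hz)
    (fun k z hz => (hd k z hz).hasFDerivAt) (fun z hz => hl z (hsub' hz))
    (Metric.mem_ball_self (by linarith))).differentiableAt

/-- The weighted Bergman space `A²ₘ(𝔹ⁿ)`: the elements of `L²(𝔹ⁿ, (-r)ᵐ dμ)` that are
represented by a function holomorphic in the unit ball. -/
def bergman (n m : ℕ) : Submodule ℂ (Lp ℂ 2 (weightedMeasure n m)) where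
  carrier := {φ | ∃ F : Cn n → ℂ, DifferentiableOn ℂ F (unitBall n) ∧ φ =ᵐ[weightedMeasure n m] F}
  zero_mem' := ⟨0, differentiableOn_const 0, Lp.coeFn_zero _ _ _⟩
  add_mem' := by
    rintro φ ψ ⟨F, hF, hφ⟩ ⟨G, hG, hψ⟩
    exact ⟨F + G, hF.add hG, (Lp.coeFn_add φ ψ).trans (hφ.add hψ)⟩
  smul_mem' := by
    rintro c φ ⟨F, hF, hφ⟩
    exact ⟨c • F, hF.const_smul c, (Lp.coeFn_smul c φ).trans (hφ.const_smul c)⟩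

theorem isClosed_bergman (n m : ℕ) :
    IsClosed (bergman n m : Set (Lp ℂ 2 (weightedMeasure n m))) := by
  refine IsSeqClosed.isClosed fun φ ψ hφ hlim => ?_
  choose f hf hφf using hφ
  have hsub : ∀ k l, eLpNorm (fun z => f k z - f l z) 2 (weightedMeasure n m)
      = edist (φ k) (φ l) := by
    intro k l
    rw [Lp.edist_def]
    exact eLpNorm_congr_ae ((hφf k).sub (hφf l)).symm
  have hloc : ∀ z₀ ∈ unitBall n, ∃ ρ : ℝ, 0 < ρ ∧ Metric.ball z₀ ρ ⊆ unitBall n ∧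
      UniformCauchySeqOn f atTop (Metric.ball z₀ ρ) := by
    intro z₀ hz₀
    obtain ⟨ρ, hρ, hsubset, K, hK, hb⟩ := exists_pointwise_bound m hz₀
    refine ⟨ρ, hρ, hsubset, ?_⟩
    rw [Metric.uniformCauchySeqOn_iff]
    intro ε hε
    have hK1 : 0 < K.toReal + 1 := by positivity
    obtain ⟨N, hN⟩ := Metric.cauchySeq_iff.1 hlim.cauchySeq (ε / (K.toReal + 1)) (by positivity)
    refine ⟨N, fun k hk l hl z hz => ?_⟩
    have h1 := hb _ ((hf k).sub (hf l)) z hz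
    have h2 : ‖f k z - f l z‖ₑ ≤ K * edist (φ k) (φ l) := hsub k l ▸ h1
    have h3 := ENNReal.toReal_mono (ENNReal.mul_ne_top hK (edist_ne_top _ _)) h2
    rw [toReal_enorm, ENNReal.toReal_mul, ← dist_edist, ← dist_eq_norm] at h3
    have h4 := hN k hk l hl
    rw [lt_div_iff₀ hK1] at h4
    have h5 : (0 : ℝ) ≤ dist (φ k) (φ l) := dist_nonneg
    nlinarith
  have hex : ∀ z, ∃ w : ℂ, z ∈ unitBall n → Tendsto (fun k => f k z) atTop (𝓝 w) := by
    intro z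
    by_cases hz : z ∈ unitBall n
    · obtain ⟨ρ, hρ, -, hc⟩ := hloc z hz
      obtain ⟨w, hw⟩ := cauchySeq_tendsto_of_complete (hc.cauchySeq (Metric.mem_ball_self hρ))
      exact ⟨w, fun _ => hw⟩
    · exact ⟨0, fun h => absurd h hz⟩
  choose F hF using hex
  refine ⟨F, fun z hz => ?_, ?_⟩
  · obtain ⟨ρ, hρ, hsubset, hc⟩ := hloc z hz
    exact (differentiableAt_of_uniformCauchySeqOn hρ (fun k => (hf k).mono hsubset) hc
      fun w hw => hF w (hsubset hw)).differentiableWithinAt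
  · obtain ⟨ns, hns, hae⟩ :=
      (tendstoInMeasure_of_tendsto_Lp hlim).exists_seq_tendsto_ae
    filter_upwards [hae, ae_all_iff.2 hφf, ae_mem_unitBall n m] with z h1 h2 h3
    refine tendsto_nhds_unique h1 ?_
    simp only [h2]
    exact (hF z h3).comp hns.tendsto_atTop

instance completeSpace_bergman (n m : ℕ) : CompleteSpace (bergman n m) :=
  (isClosed_bergman n m).completeSpace_coe


theorem memLp_top_symbol {n : ℕ} (m : ℕ) (f : C(Cn n, ℂ)) :
    MemLp f ∞ (weightedMeasure n m) := by
  obtain ⟨C, hC⟩ := (isCompact_closedBall (0 : Cn n) 1).exists_bound_of_continuousOn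
    f.continuous.continuousOn
  refine memLp_top_of_bound f.continuous.aestronglyMeasurable C ?_
  filter_upwards [ae_mem_unitBall n m] with z hz
  exact hC z (Metric.ball_subset_closedBall hz)

/-- Multiplication by a continuous function on the weighted `L²` space. -/
def mulOp (n m : ℕ) (f : C(Cn n, ℂ)) :
    Lp ℂ 2 (weightedMeasure n m) →L[ℂ] Lp ℂ 2 (weightedMeasure n m) :=
  (ContinuousLinearMap.mul ℂ ℂ).holderL (weightedMeasure n m) ∞ 2 2
    ((memLp_top_symbol m f).toLp f)

theorem mulOp_ae (n m : ℕ) (f : C(Cn n, ℂ)) (φ : Lp ℂ 2 (weightedMeasure n m)) :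
    mulOp n m f φ =ᵐ[weightedMeasure n m] fun z => f z * φ z := by
  have h1 := (ContinuousLinearMap.mul ℂ ℂ).coeFn_holder (r := 2)
    ((memLp_top_symbol m f).toLp f) φ
  refine h1.trans ?_
  filter_upwards [(memLp_top_symbol m f).coeFn_toLp] with z hz
  simp [hz]

/-- The weighted Bergman space `A²ₘ(𝔹ⁿ)` as a Hilbert space. -/
def BergmanSpace (n m : ℕ) : Type := bergman n m

instance (n m : ℕ) : NormedAddCommGroup (BergmanSpace n m) :=
  inferInstanceAs (NormedAddCommGroup (bergman n m))

instance (n m : ℕ) : InnerProductSpace ℂ (BergmanSpace n m) :=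
  inferInstanceAs (InnerProductSpace ℂ (bergman n m))

instance (n m : ℕ) : CompleteSpace (BergmanSpace n m) :=
  inferInstanceAs (CompleteSpace (bergman n m))

/-- The inclusion of the weighted Bergman space into the weighted `L²` space. -/
def incl (n m : ℕ) : BergmanSpace n m →L[ℂ] Lp ℂ 2 (weightedMeasure n m) :=
  (bergman n m).subtypeL

/-- The orthogonal projection of the weighted `L²` space onto the weighted Bergman space. -/
def proj (n m : ℕ) : Lp ℂ 2 (weightedMeasure n m) →L[ℂ] BergmanSpace n m :=
  (bergman n m).orthogonalProjectionOnto

/-- The Toeplitz operator `T_f φ = Π (f φ)` on the weighted Bergman space, where `Π` is the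
orthogonal projection of the weighted `L²` space onto the Bergman space. -/
def toeplitz (n m : ℕ) (f : C(Cn n, ℂ)) : BergmanSpace n m →L[ℂ] BergmanSpace n m :=
  proj n m ∘L mulOp n m f ∘L incl n m

theorem inner_incl_left (n m : ℕ) (φ : BergmanSpace n m) (ψ : Lp ℂ 2 (weightedMeasure n m)) :
    inner ℂ (incl n m φ) ψ = inner ℂ φ (proj n m ψ) :=
  (Submodule.inner_orthogonalProjectionOnto_eq_of_mem_left (K := bergman n m) φ ψ).symm

theorem inner_incl_right (n m : ℕ) (φ : BergmanSpace n m) (ψ : Lp ℂ 2 (weightedMeasure n m)) :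
    inner ℂ ψ (incl n m φ) = inner ℂ (proj n m ψ) φ :=
  (Submodule.inner_orthogonalProjectionOnto_eq_of_mem_right (K := bergman n m) φ ψ).symm

theorem star_toeplitz (n m : ℕ) (f : C(Cn n, ℂ)) :
    star (toeplitz n m f) = toeplitz n m (star f) := by
  rw [ContinuousLinearMap.star_eq_adjoint, eq_comm, ContinuousLinearMap.eq_adjoint_iff]
  intro φ ψ
  simp only [toeplitz, ContinuousLinearMap.comp_apply]
  rw [← inner_incl_left, ← inner_incl_right, L2.inner_def, L2.inner_def]
  refine integral_congr_ae ?_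
  filter_upwards [mulOp_ae n m (star f) (incl n m φ), mulOp_ae n m f (incl n m ψ)] with z h1 h2
  rw [h1, h2]
  simp
  ring

/-- The coordinate function `z ↦ z_j`. -/
def coord (n : ℕ) (j : Fin n) : C(Cn n, ℂ) where
  toFun z := z j
  continuous_toFun := by fun_prop

/-- The polynomial functions in `z` and `z̄`: the `*`-algebra of functions generated by the
coordinates. -/
def polynomials (n : ℕ) : StarSubalgebra ℂ C(Cn n, ℂ) :=
  StarAlgebra.adjoin ℂ (Set.range (coord n))

/-- The `*`-algebra generated by the Toeplitz operators with polynomial symbol. -/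
def toeplitzAlgebra (n m : ℕ) : StarSubalgebra ℂ (BergmanSpace n m →L[ℂ] BergmanSpace n m) :=
  StarAlgebra.adjoin ℂ {T | ∃ p ∈ polynomials n, T = toeplitz n m p}

/-- The unbounded operator `D_m = (T_{-r})⁻¹`, with domain the range of `T_{-r}`. -/
def dirac (n m : ℕ) : BergmanSpace n m →ₗ.[ℂ] BergmanSpace n m :=
  ((toeplitz n m (-defFun n)).toLinearMap.toPMap ⊤).inverse

/-- The sequences `(T_p^{(m)})_m` with the same polynomial symbol `p` at all levels. -/
def constSequences (n : ℕ) : Set (∀ m, toeplitzAlgebra n m) :=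
  {a | ∃ p ∈ polynomials n, ∀ m, (a m : BergmanSpace n m →L[ℂ] BergmanSpace n m) = toeplitz n m p}

theorem star_constSequences (n : ℕ) : star (constSequences n) = constSequences n := by
  have key : ∀ a ∈ constSequences n, star a ∈ constSequences n := by
    rintro a ⟨p, hp, ha⟩
    exact ⟨star p, star_mem hp, fun m => by
      rw [Pi.star_apply, StarMemClass.coe_star, ha, star_toeplitz]⟩
  refine Set.Subset.antisymm (fun a ha => ?_) (fun a ha => key a ha)
  simpa using key _ ha

/-- The algebra generated by the sequences `(T_p^{(m)})_m`; it is closed under the involution. -/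
def constAlgebra (n : ℕ) : StarSubalgebra ℂ (∀ m, toeplitzAlgebra n m) where
  __ := Algebra.adjoin ℂ (constSequences n)
  star_mem' := by
    intro a ha
    have h := Subalgebra.star_adjoin_comm ℂ (constSequences n)
    rw [star_constSequences] at h
    change star a ∈ Algebra.adjoin ℂ (constSequences n)
    rw [← h, Subalgebra.star_mem_star_iff]
    exact ha

/-- The identity representation of the Toeplitz algebra on the weighted Bergman space. -/
def rep (n m : ℕ) : toeplitzAlgebra n m →⋆ₐ[ℂ] (BergmanSpace n m →L[ℂ] BergmanSpace n m) :=
  (toeplitzAlgebra n m).subtype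

/-- The weights `α_m = m + 1`. -/
def weight (m : ℕ) : ℝ := m + 1

/-- The closure of `⊕ₘ αₘ Dₘ`. -/
def sumDirac (n : ℕ) :
    SpectralTriple.HilbertSum (BergmanSpace n) →ₗ.[ℂ] SpectralTriple.HilbertSum (BergmanSpace n) :=
  (SpectralTriple.sumOp (dirac n) weight).closure

end BergmanTriple

end

/-!
All operators in the theorem act diagonally on explicit orthonormal bases, and everything follows
from the list of eigenvalues.

The normalized monomials `z^β` form a Hilbert basis of the weighted Bergman space `A²ₘ` of the ball
(`monomialBasis`). They are orthogonal because `z^β` transforms under the torus by the character `β`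
and a function of nonzero weight has integral zero (`IsWeight.integral_eq_zero`). For completeness,
let `φ` be orthogonal to all monomials. The Bergman projection commutes with the torus, so that it
maps a polynomial in `z`, `z̄` of definite weight to a holomorphic function of the same weight,
which is a multiple of a monomial by the maximum principle in each variable
(`exists_eq_const_mul_monomialFun`). Hence `φ` is orthogonal to all polynomials in `z`, `z̄`, which
are dense in `L²` by the Stone–Weierstrass theorem, and `φ = 0`.

Polar coordinates and an integration by parts give
`T_{-r} z^β = (m + 1) / (n + m + 1 + |β|) z^β` (`integral_norm_monomial_succ`). Thus `αₘ Dₘ` is the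
maximal diagonal operator (`IsDiagonal`) with the eigenvalues `n + 1 + m + |β|`, and the closure of
`⊕ₘ αₘ Dₘ` is the maximal diagonal operator with the same eigenvalues on the union of the bases
(`isDiagonal_sumDirac`). A maximal diagonal operator is selfadjoint, it has compact resolvent when
its eigenvalues tend to infinity, and `Tr |D|⁻ˢ` is the sum of the `|λ|⁻ˢ`. The eigenvalue
`n + 1 + j` of the sum occurs `(n + j).choose n` times, which grows like `jⁿ`; so the trace is
finite exactly when `s > n + 1` (`tsum_rpow_lt_top_iff`).

The commutator of a diagonal operator with `a` has the matrix entries `(λᵢ - λⱼ) aᵢⱼ`. If `p` has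
weight `w`, then `T_p` shifts exponents by `w`, so that `[αₘ Dₘ, T_p] = (∑ⱼ wⱼ) T_p`. Hence for
every polynomial `p` there is one symbol `q` with `[αₘ Dₘ, T_p] = T_q` for all `m`
(`exists_isCommutator_toeplitz`), and `‖T_q‖ ≤ sup |q|` bounds these commutators uniformly in `m`.
-/

noncomputable section

namespace SpectralTriple

/-! ### Diagonal operators on a Hilbert space -/

section Diagonal

variable {ι H : Type*} [NormedAddCommGroup H] [InnerProductSpace ℂ H]

theorem _root_.HilbertBasis.ext_inner (b : HilbertBasis ι ℂ H) {v w : H}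
    (h : ∀ i, inner ℂ (b i) v = inner ℂ (b i) w) : v = w := by
  refine b.repr.injective (lp.ext (funext fun i => ?_))
  simpa only [HilbertBasis.repr_apply_apply] using h i

theorem _root_.HilbertBasis.inner_eq_ite [DecidableEq ι] (b : HilbertBasis ι ℂ H) (i j : ι) :
    inner ℂ (b i) (b j) = if i = j then (1 : ℂ) else 0 :=
  orthonormal_iff_ite.1 b.orthonormal i j

theorem _root_.HilbertBasis.inner_self_eq_one (b : HilbertBasis ι ℂ H) (i : ι) :
    inner ℂ (b i) (b i) = (1 : ℂ) := by
  classical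
  rw [b.inner_eq_ite, if_pos rfl]

theorem _root_.HilbertBasis.inner_eq_zero_of_ne (b : HilbertBasis ι ℂ H) {i j : ι} (h : i ≠ j) :
    inner ℂ (b i) (b j) = (0 : ℂ) :=
  b.orthonormal.2 h

/-- Both sides vanish unless `i = j`: a diagonal matrix may be read off by rows or by columns. -/
theorem _root_.HilbertBasis.mul_inner_comm (b : HilbertBasis ι ℂ H) (c : ι → ℂ) (i j : ι) :
    c i * inner ℂ (b j) (b i) = c j * inner ℂ (b j) (b i) := by
  rcases eq_or_ne j i with rfl | h
  · rfl
  · rw [b.inner_eq_zero_of_ne h, mul_zero, mul_zero]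

theorem _root_.HilbertBasis.norm_le_of_norm_inner_le (b : HilbertBasis ι ℂ H) {C : ℝ} (hC : 0 ≤ C)
    {v w : H} (h : ∀ i, ‖inner ℂ (b i) v‖ ≤ C * ‖inner ℂ (b i) w‖) : ‖v‖ ≤ C * ‖w‖ := by
  have h1 : ‖b.repr v‖ ≤ ‖(C : ℂ) • b.repr w‖ := by
    refine lp.norm_mono two_ne_zero fun i => ?_
    rw [lp.coeFn_smul, Pi.smul_apply, norm_smul, b.repr_apply_apply, b.repr_apply_apply,
      Complex.norm_of_nonneg hC]
    exact h i
  rwa [norm_smul, Complex.norm_of_nonneg hC, b.repr.norm_map, b.repr.norm_map] at h1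

/-- The bounded operator acting on the Hilbert basis `b` by the bounded sequence `c`. -/
def diagCLM (b : HilbertBasis ι ℂ H) (c : ι → ℂ) {C : ℝ} (hC : 0 ≤ C) (hc : ∀ i, ‖c i‖ ≤ C) :
    H →L[ℂ] H :=
  (b.repr.symm : lp (fun _ : ι => ℂ) 2 →L[ℂ] H) ∘L
    lp.mapCLM 2 (fun i => c i • ContinuousLinearMap.id ℂ ℂ) hC
      (fun i => by simpa [norm_smul] using hc i) ∘L (b.repr : H →L[ℂ] lp (fun _ : ι => ℂ) 2)

theorem inner_diagCLM (b : HilbertBasis ι ℂ H) (c : ι → ℂ) {C : ℝ} (hC : 0 ≤ C)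
    (hc : ∀ i, ‖c i‖ ≤ C) (v : H) (i : ι) :
    inner ℂ (b i) (diagCLM b c hC hc v) = c i * inner ℂ (b i) v := by
  simp [← HilbertBasis.repr_apply_apply, diagCLM]

theorem norm_le_of_inner_eq (b : HilbertBasis ι ℂ H) {T : H →L[ℂ] H} {c : ι → ℂ} {C : ℝ}
    (hC : 0 ≤ C) (hc : ∀ i, ‖c i‖ ≤ C)
    (hT : ∀ v i, inner ℂ (b i) (T v) = c i * inner ℂ (b i) v) : ‖T‖ ≤ C :=
  T.opNorm_le_bound hC fun v => b.norm_le_of_norm_inner_le hC fun i => by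
    rw [hT, norm_mul]
    exact mul_le_mul_of_nonneg_right (hc i) (norm_nonneg _)

/-- `D` is the maximal operator acting diagonally on the Hilbert basis `b` with the real
eigenvalues `lam`: its graph consists of all pairs `(v, w)` with `wᵢ = lamᵢ vᵢ`. -/
def IsDiagonal (D : H →ₗ.[ℂ] H) (b : HilbertBasis ι ℂ H) (lam : ι → ℝ) : Prop :=
  ∀ v w, (v, w) ∈ D.graph ↔ ∀ i, inner ℂ (b i) w = (lam i : ℂ) * inner ℂ (b i) v

namespace IsDiagonal

variable {D : H →ₗ.[ℂ] H} {b : HilbertBasis ι ℂ H} {lam : ι → ℝ}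

theorem inner_apply (h : IsDiagonal D b lam) (v : D.domain) (i : ι) :
    inner ℂ (b i) (D v) = (lam i : ℂ) * inner ℂ (b i) (v : H) :=
  (h v (D v)).1 (D.mem_graph v) i

theorem exists_apply_eq (h : IsDiagonal D b lam) {v w : H}
    (hvw : ∀ i, inner ℂ (b i) w = (lam i : ℂ) * inner ℂ (b i) v) :
    ∃ hv : v ∈ D.domain, D ⟨v, hv⟩ = w := by
  obtain ⟨y, hy, hy'⟩ := D.mem_graph_iff.1 ((h v w).2 hvw)
  subst hy
  exact ⟨y.2, hy'⟩

theorem exists_apply_basis (h : IsDiagonal D b lam) (i : ι) :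
    ∃ hv : b i ∈ D.domain, D ⟨b i, hv⟩ = (lam i : ℂ) • b i := by
  refine h.exists_apply_eq fun j => ?_
  rw [inner_smul_right]
  exact b.mul_inner_comm (fun i => (lam i : ℂ)) i j

theorem dense_domain (h : IsDiagonal D b lam) : Dense (D.domain : Set H) := by
  have h1 : Submodule.span ℂ (Set.range b) ≤ D.domain :=
    Submodule.span_le.2 (by rintro _ ⟨i, rfl⟩; exact (h.exists_apply_basis i).1)
  have h2 : Dense (Submodule.span ℂ (Set.range b) : Set H) :=
    Submodule.dense_iff_topologicalClosure_eq_top.2 b.dense_span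
  exact h2.mono h1

theorem smul (h : IsDiagonal D b lam) {c : ℝ} (hc : c ≠ 0) :
    IsDiagonal ((c : ℂ) • D) b fun i => c * lam i := by
  have hc' : (c : ℂ) ≠ 0 := by exact_mod_cast hc
  intro v w
  have key : (v, w) ∈ ((c : ℂ) • D).graph ↔ (v, (c : ℂ)⁻¹ • w) ∈ D.graph := by
    simp only [LinearPMap.mem_graph_iff]
    constructor
    · rintro ⟨y, rfl, hy⟩
      refine ⟨y, rfl, ?_⟩
      rw [← hy]
      exact (inv_smul_smul₀ hc' _).symm
    · rintro ⟨y, rfl, hy⟩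
      refine ⟨y, rfl, ?_⟩
      change (c : ℂ) • D y = w
      rw [hy, smul_inv_smul₀ hc']
  rw [key, h]
  refine forall_congr' fun i => ?_
  rw [inner_smul_right, inv_mul_eq_iff_eq_mul₀ hc']
  push_cast
  rw [mul_assoc]

/-- The inverse of a bounded injective diagonal operator, with domain the range of that operator, is
the maximal diagonal operator. -/
theorem of_inverse {T : H →L[ℂ] H} {c : ι → ℝ} (hc : ∀ i, c i ≠ 0)
    (hT : ∀ v i, inner ℂ (b i) (T v) = (c i : ℂ) * inner ℂ (b i) v) :
    IsDiagonal (T.toLinearMap.toPMap ⊤).inverse b fun i => (c i)⁻¹ := by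
  have hc' : ∀ i, (c i : ℂ) ≠ 0 := fun i => by exact_mod_cast hc i
  have hker : LinearMap.ker (T.toLinearMap.toPMap ⊤).toFun = ⊥ := by
    refine LinearMap.ker_eq_bot'.2 fun v hv => Subtype.ext (b.ext_inner fun i => ?_)
    have h1 : T v = 0 := hv
    have h2 := hT v i
    rw [h1, inner_zero_right, eq_comm, mul_eq_zero] at h2
    simpa using h2.resolve_left (hc' i)
  intro v w
  have key : (v, w) ∈ (T.toLinearMap.toPMap ⊤).inverse.graph ↔ T w = v := by
    rw [LinearPMap.inverse_graph hker]
    simp [LinearMap.toPMap]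
  rw [key]
  constructor
  · rintro rfl i
    rw [hT]
    push_cast
    rw [inv_mul_cancel_left₀ (hc' i)]
  · intro h
    refine b.ext_inner fun i => ?_
    rw [hT, h]
    push_cast
    rw [mul_inv_cancel_left₀ (hc' i)]

/-- An operator which is contained in the maximal diagonal operator and is defined on the basis
vectors has the maximal diagonal operator as its closure. -/
theorem closure
    (hle : ∀ v : D.domain, ∀ i, inner ℂ (b i) (D v) = (lam i : ℂ) * inner ℂ (b i) (v : H))
    (hmem : ∀ i, b i ∈ D.domain) : IsDiagonal D.closure b lam := by
  let G : Submodule ℂ (H × H) :=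
    { carrier := {p | ∀ i, inner ℂ (b i) p.2 = (lam i : ℂ) * inner ℂ (b i) p.1}
      zero_mem' := fun i => by simp
      add_mem' := fun {p q} hp hq i => by
        simp only [Prod.snd_add, Prod.fst_add, inner_add_right, hp i, hq i, mul_add]
      smul_mem' := fun c p hp i => by
        simp only [Prod.smul_snd, Prod.smul_fst, inner_smul_right, hp i]
        ring }
  have hGc : IsClosed (G : Set (H × H)) := by
    have : (G : Set (H × H)) =
        ⋂ i, {p : H × H | inner ℂ (b i) p.2 = (lam i : ℂ) * inner ℂ (b i) p.1} := by
      ext p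
      simp [G]
    rw [this]
    exact isClosed_iInter fun i => isClosed_eq (by fun_prop) (by fun_prop)
  have hDb : ∀ i, D ⟨b i, hmem i⟩ = (lam i : ℂ) • b i := fun i =>
    b.ext_inner fun j => by
      rw [hle, inner_smul_right]
      exact (b.mul_inner_comm (fun i => (lam i : ℂ)) i j).symm
  -- a point of the maximal graph is the limit of its Fourier partial sums, which lie in `D.graph`
  have h1 : D.graph.topologicalClosure = G := by
    refine le_antisymm (Submodule.topologicalClosure_minimal _ ?_ hGc) ?_
    · rintro ⟨v, w⟩ hvw
      obtain ⟨y, rfl, rfl⟩ := D.mem_graph_iff.1 hvw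
      exact fun i => hle y i
    · rintro ⟨v, w⟩ hvw
      have hs : HasSum (fun i => (inner ℂ (b i) v • b i, inner ℂ (b i) w • b i)) (v, w) := by
        have hv := b.hasSum_repr v
        have hw := b.hasSum_repr w
        simp only [HilbertBasis.repr_apply_apply] at hv hw
        exact hv.prodMk hw
      refine mem_closure_of_tendsto hs (Eventually.of_forall fun s => ?_)
      refine Submodule.sum_mem _ fun i _ => ?_
      have h2 : (b i, (lam i : ℂ) • b i) ∈ D.graph :=
        D.mem_graph_iff.2 ⟨⟨b i, hmem i⟩, rfl, hDb i⟩
      have h3 := D.graph.smul_mem (inner ℂ (b i) v) h2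
      have h4 := hvw i
      dsimp only at h4
      rw [Prod.smul_mk, smul_smul, mul_comm, ← h4] at h3
      exact h3
  have h2 : ∀ x ∈ G, x.1 = 0 → x.2 = 0 := fun x hx hx0 => b.ext_inner fun i => by
    rw [hx i, hx0]
    simp
  have h3 : D.IsClosable := ⟨G.toLinearPMap, by rw [h1, Submodule.toLinearPMap_graph_eq _ h2]⟩
  intro v w
  rw [← h3.graph_closure_eq_closure_graph, h1]
  rfl

theorem isSelfAdjoint [CompleteSpace H] (h : IsDiagonal D b lam) : IsSelfAdjoint D := by
  refine LinearPMap.isSelfAdjoint_def.2 (LinearPMap.eq_of_eq_graph ?_)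
  ext ⟨v, w⟩
  rw [LinearPMap.adjoint_graph_eq_graph_adjoint h.dense_domain, Submodule.mem_adjoint_iff, h]
  simp only [h _ _]
  constructor
  · intro H i
    have := H (b i) ((lam i : ℂ) • b i) fun j => by
      rw [inner_smul_right]
      exact b.mul_inner_comm (fun i => (lam i : ℂ)) i j
    rw [inner_smul_left, Complex.conj_ofReal, sub_eq_zero] at this
    exact this.symm
  · intro H x y hxy
    rw [← b.tsum_inner_mul_inner, ← b.tsum_inner_mul_inner x w, sub_eq_zero]
    refine tsum_congr fun i => ?_
    rw [H i, ← inner_conj_symm, hxy i, map_mul, Complex.conj_ofReal, inner_conj_symm]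
    ring

theorem isCompactOperator_of_isResolventAt [CompleteSpace H] (h : IsDiagonal D b lam)
    (hlam : Tendsto (fun i => |lam i|) cofinite atTop) {z : ℂ} {R : H →L[ℂ] H}
    (hR : IsResolventAt D z R) : IsCompactOperator R := by
  classical
  have h1 : ∀ x i, ((lam i : ℂ) - z) * inner ℂ (b i) (R x) = inner ℂ (b i) x := by
    intro x i
    obtain ⟨hx, hx'⟩ := hR.1 x
    conv_rhs => rw [← hx', inner_sub_right, h.inner_apply ⟨R x, hx⟩, inner_smul_right]
    ring
  have h2 : ∀ i, (lam i : ℂ) - z ≠ 0 := fun i h0 => by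
    have := h1 (b i) i
    rw [h0, zero_mul, b.inner_self_eq_one] at this
    exact zero_ne_one this
  have h3 : ∀ x i, inner ℂ (b i) (R x) = ((lam i : ℂ) - z)⁻¹ * inner ℂ (b i) x := fun x i => by
    rw [← h1 x, inv_mul_cancel_left₀ (h2 i)]
  -- `R` is the norm limit of its finite rank truncations
  let F : Finset ι → (H →L[ℂ] H) := fun s =>
    ∑ i ∈ s, ((lam i : ℂ) - z)⁻¹ • (innerSL ℂ (b i)).smulRight (b i)
  have hF : ∀ s x i, inner ℂ (b i) (F s x)
      = (if i ∈ s then ((lam i : ℂ) - z)⁻¹ else 0) * inner ℂ (b i) x := by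
    intro s x i
    simp only [F, sum_apply, inner_sum, smul_apply,
      ContinuousLinearMap.smulRight_apply, inner_smul_right, b.inner_eq_ite, innerSL_apply_apply]
    simp
  refine isCompactOperator_of_tendsto (l := atTop) (F := F) ?_ (Eventually.of_forall fun s => ?_)
  · rw [Metric.tendsto_atTop]
    intro ε hε
    have h4 : ∀ᶠ i in cofinite, 2 / ε + ‖z‖ ≤ |lam i| := hlam.eventually_ge_atTop _
    refine ⟨(eventually_cofinite.1 h4).toFinset, fun s hs => ?_⟩
    rw [dist_eq_norm]
    refine (norm_le_of_inner_eq b (C := ε / 2)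
      (c := fun i => (if i ∈ s then ((lam i : ℂ) - z)⁻¹ else 0) - ((lam i : ℂ) - z)⁻¹)
      (by positivity) (fun i => ?_) fun v i => ?_).trans_lt (by linarith)
    · by_cases hi : i ∈ s
      · simp only [hi, if_true, sub_self, norm_zero]
        positivity
      · have h5 : 2 / ε + ‖z‖ ≤ |lam i| := by
          by_contra h6
          exact hi (hs (by simpa using h6))
        have h7 : |lam i| ≤ ‖(lam i : ℂ) - z‖ + ‖z‖ := by
          have := norm_add_le ((lam i : ℂ) - z) z
          simpa using this
        simp only [hi, if_false, zero_sub, norm_neg, norm_inv]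
        rw [← inv_div]
        exact inv_anti₀ (by positivity) (by linarith)
    · rw [sub_apply, inner_sub_right, hF, h3]
      ring
  · refine (compactOperator (RingHom.id ℂ) H H).sum_mem fun i _ => ?_
    refine (compactOperator (RingHom.id ℂ) H H).smul_mem _ ?_
    have h5 : IsCompactOperator (innerSL ℂ (b i)) :=
      isCompactOperator_of_locallyCompactSpace_dom (innerSL ℂ (b i))
    exact h5.clm_comp (ContinuousLinearMap.toSpanSingleton ℂ (b i))

/-- A bounded operator with the matrix entries `(lamᵢ - lamⱼ) aᵢⱼ` is the commutator `[D, a]`; in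
particular `a` preserves the domain of `D`. -/
theorem isCommutator (h : IsDiagonal D b lam) {a B : H →L[ℂ] H}
    (hB : ∀ i j, inner ℂ (b i) (B (b j)) = ((lam i : ℂ) - lam j) * inner ℂ (b i) (a (b j))) :
    IsCommutator D a B := by
  have hexp : ∀ (T : H →L[ℂ] H) (v : H) (i : ι),
      HasSum (fun j => inner ℂ (b j) v * inner ℂ (b i) (T (b j))) (inner ℂ (b i) (T v)) := by
    intro T v i
    have := ((innerSL ℂ (b i)) ∘L T).hasSum (b.hasSum_repr v)
    simpa [HilbertBasis.repr_apply_apply, inner_smul_right] using this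
  intro v
  have key : ∀ i, inner ℂ (b i) (a (D v) + B v) = (lam i : ℂ) * inner ℂ (b i) (a (v : H)) := by
    intro i
    have h1 := (hexp a (D v) i).add (hexp B v i)
    have h2 := (hexp a v i).mul_left (lam i : ℂ)
    rw [inner_add_right]
    refine h1.unique (h2.congr_fun fun j => ?_)
    rw [h.inner_apply, hB]
    ring
  obtain ⟨hv, hv'⟩ := h.exists_apply_eq key
  exact ⟨hv, by rw [hv']; abel⟩

theorem inner_commutator (h : IsDiagonal D b lam) {a B : H →L[ℂ] H} (hB : IsCommutator D a B)
    (i j : ι) :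
    inner ℂ (b i) (B (b j)) = ((lam i : ℂ) - lam j) * inner ℂ (b i) (a (b j)) := by
  obtain ⟨h1, h2⟩ := h.exists_apply_basis j
  obtain ⟨h3, h4⟩ := hB ⟨b j, h1⟩
  rw [← h4, h2, inner_sub_right, h.inner_apply, map_smul, inner_smul_right]
  ring

end IsDiagonal

end Diagonal

/-! ### Spectral calculus of diagonal operators -/

section Diagonal

variable {ι H : Type*} [NormedAddCommGroup H] [InnerProductSpace ℂ H]

theorem _root_.HilbertBasis.hasSum_norm_sq (b : HilbertBasis ι ℂ H) (v : H) :
    HasSum (fun i => ‖(inner ℂ (b i) v : ℂ)‖ ^ 2) (‖v‖ ^ 2) := by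
  have h := b.hasSum_inner_mul_inner v v
  rw [inner_self_eq_norm_sq_to_K] at h
  have h2 : HasSum (fun i => ((‖(inner ℂ (b i) v : ℂ)‖ ^ 2 : ℝ) : ℂ)) ((‖v‖ ^ 2 : ℝ) : ℂ) := by
    push_cast
    refine h.congr_fun fun i => ?_
    rw [← inner_conj_symm v (b i), Complex.conj_mul']
  exact_mod_cast h2

theorem _root_.HilbertBasis.tsum_enorm_sq (b : HilbertBasis ι ℂ H) (v : H) :
    ∑' i, ‖(inner ℂ (b i) v : ℂ)‖ₑ ^ 2 = ‖v‖ₑ ^ 2 := by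
  have h := b.hasSum_norm_sq v
  have h1 := ENNReal.ofReal_tsum_of_nonneg (fun i => sq_nonneg _) h.summable
  rw [h.tsum_eq] at h1
  simpa only [ENNReal.ofReal_pow (norm_nonneg _), ofReal_norm] using h1.symm

namespace IsDiagonal

variable {D : H →ₗ.[ℂ] H} {b : HilbertBasis ι ℂ H} {lam : ι → ℝ}

theorem mem_eigenspace_iff (h : IsDiagonal D b lam) {t : ℝ} {v : H} :
    v ∈ eigenspace D t ↔ ∀ i, lam i ≠ t → inner ℂ (b i) v = 0 := by
  constructor
  · rintro ⟨hv, hv'⟩ i hi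
    have h1 := h.inner_apply ⟨v, hv⟩ i
    rw [hv', inner_smul_right, ← sub_eq_zero, ← sub_mul, mul_eq_zero] at h1
    refine h1.resolve_left ?_
    rw [sub_eq_zero]
    exact_mod_cast hi.symm
  · intro hv
    refine h.exists_apply_eq fun i => ?_
    rw [inner_smul_right]
    by_cases hi : lam i = t
    · rw [hi]
    · rw [hv i hi, mul_zero, mul_zero]

theorem inner_eigenprojection [CompleteSpace H] (h : IsDiagonal D b lam) (t : ℝ) (v : H) (i : ι) :
    inner ℂ (b i) (eigenprojection D t v) = if lam i = t then inner ℂ (b i) v else 0 := by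
  let Q := diagCLM b (fun i => if lam i = t then 1 else 0) zero_le_one fun i => by
    split_ifs <;> simp
  have hQ : ∀ i, inner ℂ (b i) (Q v) = if lam i = t then inner ℂ (b i) v else 0 := fun i => by
    rw [inner_diagCLM]
    simp
  have h1 : eigenprojection D t v = Q v := by
    refine Submodule.eq_starProjection_of_mem_of_inner_eq_zero ?_ fun w hw => ?_
    · refine subset_closure (h.mem_eigenspace_iff.2 fun j hj => ?_)
      rw [hQ, if_neg hj]
    · have h2 : v - Q v ∈ (eigenspace D t).topologicalClosureᗮ := by
        rw [Submodule.orthogonal_closure, Submodule.mem_orthogonal']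
        intro u hu
        rw [← b.tsum_inner_mul_inner]
        refine (tsum_congr fun j => ?_).trans tsum_zero
        by_cases hj : lam j = t
        · rw [← inner_conj_symm (v - Q v), inner_sub_right, hQ, if_pos hj]
          simp
        · rw [h.mem_eigenspace_iff.1 hu j hj, mul_zero]
      exact (Submodule.mem_orthogonal' _ _).1 h2 w hw
  rw [h1, hQ]

/-- The trace is the sum over the eigenvalues counted with multiplicity. All terms are nonnegative
extended reals, so that the sums over the chosen basis, the spectrum and `b` may be interchanged. -/
theorem traceAbsPow_eq [CompleteSpace H] (h : IsDiagonal D b lam) (s : ℝ) :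
    traceAbsPow D s = ∑' i, ENNReal.ofReal |lam i| ^ (-s) := by
  classical
  obtain ⟨c, hc⟩ := (exists_hilbertBasis ℂ H).choose_spec
  have h1 : ∀ t v, ‖eigenprojection D t v‖ₑ ^ 2
      = ∑' i, if t = lam i then ‖(inner ℂ (b i) v : ℂ)‖ₑ ^ 2 else 0 := by
    intro t v
    rw [← b.tsum_enorm_sq]
    refine tsum_congr fun i => ?_
    rw [h.inner_eigenprojection]
    by_cases hi : lam i = t
    · rw [if_pos hi, if_pos hi.symm]
    · rw [if_neg hi, if_neg (Ne.symm hi)]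
      simp
  have h2 : ∀ v, absPowForm D s v
      = ∑' i, ENNReal.ofReal |lam i| ^ (-s) * ‖(inner ℂ (b i) v : ℂ)‖ₑ ^ 2 := by
    intro v
    simp only [absPowForm, h1, ← ENNReal.tsum_mul_left]
    rw [ENNReal.tsum_comm]
    refine tsum_congr fun i => ?_
    rw [tsum_eq_single (lam i) fun t ht => by rw [if_neg ht, mul_zero], if_pos rfl]
  simp only [traceAbsPow, h2]
  rw [ENNReal.tsum_comm]
  refine tsum_congr fun i => ?_
  rw [ENNReal.tsum_mul_left]
  have h3 := c.tsum_enorm_sq (b i)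
  simp only [hc] at h3
  have h4 : ‖b i‖ₑ = 1 := by
    rw [← ofReal_norm, b.orthonormal.1 i, ENNReal.ofReal_one]
  rw [h4, one_pow] at h3
  conv_rhs => rw [← mul_one (ENNReal.ofReal |lam i| ^ (-s)), ← h3]
  congr 1
  refine tsum_congr fun e => ?_
  rw [← ofReal_norm, ← ofReal_norm, norm_inner_symm]

/-- The bounded operator `(1 + D²)^{-1/2}` of a diagonal operator `D` exists, and its norm is
controlled by a lower bound of the eigenvalues. -/
theorem exists_isInvSqrtOneAddSq (h : IsDiagonal D b lam) {C : ℝ} (hC : 0 < C)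
    (hlam : ∀ i, C ≤ lam i) : ∃ B, IsInvSqrtOneAddSq D B ∧ ‖B‖ ≤ C⁻¹ := by
  set c : ι → ℝ := fun i => (√(1 + lam i ^ 2))⁻¹ with hc
  have hpos : ∀ i, 0 < 1 + lam i ^ 2 := fun i => by positivity
  have hc0 : ∀ i, 0 ≤ c i := fun i => by positivity
  have hcc : ∀ i, (c i : ℂ) * c i = ((1 + lam i ^ 2 : ℝ) : ℂ)⁻¹ := fun i => by
    rw [← Complex.ofReal_mul, hc, ← mul_inv, Real.mul_self_sqrt (hpos i).le, Complex.ofReal_inv]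
  have hne : ∀ i, ((1 + lam i ^ 2 : ℝ) : ℂ) ≠ 0 := fun i => by exact_mod_cast (hpos i).ne'
  have hcC : ∀ i, ‖(c i : ℂ)‖ ≤ C⁻¹ := fun i => by
    rw [Complex.norm_of_nonneg (hc0 i)]
    exact inv_anti₀ hC ((hlam i).trans (Real.le_sqrt_of_sq_le (by linarith)))
  have hC' : 0 ≤ C⁻¹ := (inv_pos.2 hC).le
  have hsmall : ∀ i, ‖(lam i : ℂ) * ((1 + lam i ^ 2 : ℝ) : ℂ)⁻¹‖ ≤ 1 := fun i => by
    rw [← Complex.ofReal_inv, ← Complex.ofReal_mul, Complex.norm_real, Real.norm_eq_abs, abs_mul,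
      abs_of_pos (inv_pos.2 (hpos i)), ← div_eq_mul_inv, div_le_one (hpos i)]
    nlinarith [sq_abs (lam i), sq_nonneg (|lam i| - 1)]
  have hsmall2 : ∀ i, ‖(lam i : ℂ) * ((lam i : ℂ) * ((1 + lam i ^ 2 : ℝ) : ℂ)⁻¹)‖ ≤ 1 := fun i => by
    rw [← mul_assoc, ← Complex.ofReal_inv, ← Complex.ofReal_mul, ← Complex.ofReal_mul,
      Complex.norm_real, Real.norm_eq_abs, abs_mul,
      abs_of_pos (inv_pos.2 (hpos i)), ← div_eq_mul_inv, div_le_one (hpos i), abs_mul_self]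
    nlinarith
  let B := diagCLM b (fun i => (c i : ℂ)) hC' hcC
  have hB : ∀ v i, inner ℂ (b i) (B v) = (c i : ℂ) * inner ℂ (b i) v := inner_diagCLM b _ hC' hcC
  refine ⟨B, ⟨?_, fun x => ?_, fun v hv => ?_⟩, norm_le_of_inner_eq b hC' hcC hB⟩
  · rw [ContinuousLinearMap.isPositive_iff_complex]
    intro x
    have h1 : inner ℂ (B x) x = ((∑' i, c i * ‖(inner ℂ (b i) x : ℂ)‖ ^ 2 : ℝ) : ℂ) := by
      rw [← b.tsum_inner_mul_inner, Complex.ofReal_tsum]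
      refine tsum_congr fun i => ?_
      rw [← inner_conj_symm, hB, map_mul, Complex.conj_ofReal, mul_assoc, Complex.conj_mul']
      push_cast
      rfl
    rw [h1]
    refine ⟨by simp, ?_⟩
    exact (tsum_nonneg fun i => mul_nonneg (hc0 i) (sq_nonneg _)).trans_eq
      (Complex.ofReal_re _).symm
  · -- `W₁ = D (1 + D²)⁻¹` and `W₂ = D² (1 + D²)⁻¹` are bounded
    let W₁ := diagCLM b (fun i => (lam i : ℂ) * ((1 + lam i ^ 2 : ℝ) : ℂ)⁻¹) zero_le_one hsmall
    let W₂ := diagCLM b (fun i => (lam i : ℂ) * ((lam i : ℂ) * ((1 + lam i ^ 2 : ℝ) : ℂ)⁻¹))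
      zero_le_one hsmall2
    obtain ⟨k₁, e₁⟩ := h.exists_apply_eq (v := B (B x)) (w := W₁ x) fun i => by
      rw [inner_diagCLM, hB, hB, ← mul_assoc (c i : ℂ), hcc, mul_assoc]
    obtain ⟨k₂, e₂⟩ := h.exists_apply_eq (v := W₁ x) (w := W₂ x) fun i => by
      rw [inner_diagCLM, inner_diagCLM, mul_assoc]
    refine ⟨k₁, by rwa [e₁], ?_⟩
    simp only [e₁, e₂]
    refine b.ext_inner fun i => ?_
    rw [inner_add_right, hB, hB, inner_diagCLM, ← mul_assoc (c i : ℂ), hcc]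
    have := hne i
    field_simp
    push_cast
    ring
  · refine b.ext_inner fun i => ?_
    rw [hB, hB, inner_add_right, h.inner_apply ⟨D v, hv⟩, h.inner_apply v, ← mul_assoc (c i : ℂ),
      hcc, inv_mul_eq_iff_eq_mul₀ (hne i)]
    push_cast
    ring

end IsDiagonal

end Diagonal

/-! ### Hilbert sums of diagonal operators -/

section HilbertSumBasis

variable {H : ℕ → Type*} [∀ m, NormedAddCommGroup (H m)] [∀ m, InnerProductSpace ℂ (H m)]
  {ι : ℕ → Type*}

theorem inner_single_single (b : ∀ m, HilbertBasis (ι m) ℂ (H m)) (p : Σ m, ι m)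
    (v : HilbertSum H) :
    inner ℂ (lp.single 2 p.1 (b p.1 p.2) : HilbertSum H) v = inner ℂ (b p.1 p.2) (v p.1) :=
  lp.inner_single_left _ _ _

variable [∀ m, CompleteSpace (H m)]

/-- The Hilbert basis of a Hilbert sum obtained from Hilbert bases of the summands. -/
def sumBasis (b : ∀ m, HilbertBasis (ι m) ℂ (H m)) :
    HilbertBasis (Σ m, ι m) ℂ (HilbertSum H) :=
  HilbertBasis.mkOfOrthogonalEqBot
    (v := fun p : Σ m, ι m => (lp.single 2 p.1 (b p.1 p.2) : HilbertSum H))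
    (by
      classical
      rw [orthonormal_iff_ite]
      rintro ⟨m, i⟩ ⟨k, j⟩
      rw [inner_single_single]
      rcases eq_or_ne m k with rfl | hmk
      · simp [(b m).inner_eq_ite]
      · have h : (⟨m, i⟩ : Σ m, ι m) ≠ ⟨k, j⟩ := fun h => hmk (congrArg Sigma.fst h)
        rw [if_neg h]
        dsimp only
        rw [lp.single_apply_ne _ _ _ hmk, inner_zero_right])
    (by
      rw [Submodule.eq_bot_iff]
      intro v hv
      refine lp.ext (funext fun m => (b m).ext_inner fun i => ?_)
      have h := (Submodule.mem_orthogonal _ _).1 hv _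
        (Submodule.subset_span ⟨(⟨m, i⟩ : Σ m, ι m), rfl⟩)
      rw [inner_single_single] at h
      rw [h]
      simp)

theorem sumBasis_apply (b : ∀ m, HilbertBasis (ι m) ℂ (H m)) (p : Σ m, ι m) :
    sumBasis b p = lp.single 2 p.1 (b p.1 p.2) := by
  rw [sumBasis, HilbertBasis.coe_mkOfOrthogonalEqBot]

theorem inner_sumBasis (b : ∀ m, HilbertBasis (ι m) ℂ (H m)) (p : Σ m, ι m)
    (v : HilbertSum H) : inner ℂ (sumBasis b p) v = inner ℂ (b p.1 p.2) (v p.1) := by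
  rw [sumBasis_apply, inner_single_single]

variable {D : ∀ m, H m →ₗ.[ℂ] H m} {α : ℕ → ℝ} {b : ∀ m, HilbertBasis (ι m) ℂ (H m)}
  {lam : ∀ m, ι m → ℝ}

/-- The closure of the algebraic sum of diagonal operators is the maximal diagonal operator. -/
theorem isDiagonal_closure_sumOp (h : ∀ m, IsDiagonal (D m) (b m) (lam m)) :
    IsDiagonal (sumOp D α).closure (sumBasis b) fun p => α p.1 * lam p.1 p.2 := by
  refine IsDiagonal.closure (fun v p => ?_) fun p => ?_
  · rw [inner_sumBasis, inner_sumBasis]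
    change inner ℂ (b p.1 p.2) ((α p.1 : ℂ) • D p.1 ⟨(v : HilbertSum H) p.1, v.2.2 p.1⟩) = _
    rw [inner_smul_right, (h p.1).inner_apply]
    push_cast
    ring
  · rw [sumBasis_apply]
    refine ⟨⟨p.1, fun m hm => lp.single_apply_ne _ _ _ hm.ne'⟩, fun m => ?_⟩
    obtain ⟨k, i⟩ := p
    rcases eq_or_ne m k with rfl | hmk
    · rw [lp.single_apply_self]
      exact ((h m).exists_apply_basis i).1
    · rw [lp.single_apply_ne _ _ _ hmk]
      exact (D m).domain.zero_mem

theorem isCommutator_diagOp (h : ∀ m, IsDiagonal (D m) (b m) (lam m)) (hα : ∀ m, α m ≠ 0)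
    {a B : ∀ m, H m →L[ℂ] H m} (ha : ∃ C : ℝ, ∀ m, ‖a m‖ ≤ C) (hB : ∃ C : ℝ, ∀ m, ‖B m‖ ≤ C)
    (hc : ∀ m, IsCommutator ((α m : ℂ) • D m) (a m) (B m)) :
    IsCommutator (sumOp D α).closure (diagOp a ha) (diagOp B hB) := by
  refine (isDiagonal_closure_sumOp h).isCommutator fun p q => ?_
  rw [inner_sumBasis, inner_sumBasis, diagOp_apply, diagOp_apply, sumBasis_apply]
  obtain ⟨m, i⟩ := p
  obtain ⟨k, j⟩ := q
  rcases eq_or_ne m k with rfl | hmk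
  · dsimp only
    rw [lp.single_apply_self, ((h m).smul (hα m)).inner_commutator (hc m)]
  · dsimp only
    rw [lp.single_apply_ne _ _ _ hmk]
    simp

variable {A : ℕ → Type*} [∀ m, Ring (A m)] [∀ m, StarRing (A m)]
  [∀ m, Algebra ℂ (A m)] [∀ m, StarModule ℂ (A m)]
  {π : ∀ m, A m →⋆ₐ[ℂ] (H m →L[ℂ] H m)}

theorem sumRep_injective (hI : IsIntegrable π D α) : Function.Injective (sumRep hI) := by
  intro a a' haa
  refine Subtype.ext (funext fun m => (hI.spectralTriple m).faithful ?_)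
  ext v
  have h1 : diagOp (fun m => π m (a.1 m)) a.2.1 (lp.single 2 m v) m
      = diagOp (fun m => π m (a'.1 m)) a'.2.1 (lp.single 2 m v) m :=
    congrArg (fun w : HilbertSum H => w m) (congrArg (fun T => T (lp.single 2 m v)) haa)
  rwa [diagOp_apply, diagOp_apply, lp.single_apply_self] at h1

/-- The integration of an integrable family of diagonal spectral triples is a spectral triple as
soon as the joint list of eigenvalues is proper. -/
theorem isSpectralTriple_sumRep (hI : IsIntegrable π D α)
    (h : ∀ m, IsDiagonal (D m) (b m) (lam m))
    (hlam : Tendsto (fun p : Σ m, ι m => |α p.1 * lam p.1 p.2|) cofinite atTop) :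
    IsSpectralTriple (sumRep hI) (sumOp D α).closure where
  faithful := sumRep_injective hI
  selfAdjoint := (isDiagonal_closure_sumOp h).isSelfAdjoint
  compact_resolvent _ _ hR :=
    (isDiagonal_closure_sumOp h).isCompactOperator_of_isResolventAt hlam hR
  commutator a := by
    obtain ⟨C, hC⟩ := a.2.2
    choose B hB hBC using hC
    exact ⟨diagOp B ⟨C, hBC⟩, isCommutator_diagOp h hI.weight_ne_zero a.2.1 ⟨C, hBC⟩ hB⟩

theorem isSpectralTriple_subRep (hI : IsIntegrable π D α)
    {T : HilbertSum H →ₗ.[ℂ] HilbertSum H} (hT : IsSpectralTriple (sumRep hI) T)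
    {S : StarSubalgebra ℂ (∀ m, A m)} (hS : S ≤ sumAlgebra hI) :
    IsSpectralTriple (subRep hI hS) T where
  faithful := hT.faithful.comp (StarSubalgebra.inclusion_injective hS)
  selfAdjoint := hT.selfAdjoint
  compact_resolvent := hT.compact_resolvent
  commutator a := hT.commutator (StarSubalgebra.inclusion hS a)

end HilbertSumBasis

/-! ### Counting eigenvalues -/

section Counting

/-- There are `(n + j).choose n` multi-indices of length `n + 1` and total degree `j`. -/
theorem tsum_sigma_nat_pi_eq (n : ℕ) (f : ℕ → ℝ≥0∞) :
    ∑' p : (Σ _ : ℕ, Fin n → ℕ), f (p.1 + ∑ i, p.2 i) = ∑' j, ((n + j).choose n : ℝ≥0∞) * f j := by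
  let e : (Σ _ : ℕ, Fin n → ℕ) ≃ (Fin (n + 1) → ℕ) :=
    (Equiv.sigmaEquivProd ℕ (Fin n → ℕ)).trans (Fin.consEquiv fun _ => ℕ)
  have h1 : ∀ p, p.1 + ∑ i, p.2 i = ∑ i, e p i := fun p => by
    rw [Fin.sum_univ_succ]
    rfl
  simp only [h1]
  rw [e.tsum_eq fun x => f (∑ i, x i),
    ← (Equiv.sigmaFiberEquiv fun x : Fin (n + 1) → ℕ => ∑ i, x i).tsum_eq,
    ENNReal.tsum_sigma']
  refine tsum_congr fun j => ?_
  have h2 : ∀ x : {x : Fin (n + 1) → ℕ // ∑ i, x i = j},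
      f (∑ i, (Equiv.sigmaFiberEquiv fun x : Fin (n + 1) → ℕ => ∑ i, x i) ⟨j, x⟩ i) = f j :=
    fun x => congrArg f x.2
  let e' := Sym.equivNatSumOfFintype (Fin (n + 1)) j
  rw [tsum_congr h2, ← e'.tsum_eq, tsum_fintype, Finset.sum_const, Finset.card_univ,
    Sym.card_sym_eq_choose, Fintype.card_fin, nsmul_eq_mul,
    show n + 1 + j - 1 = n + j by omega, Nat.choose_symm_add]

/-- The terms of total degree `j` contribute `(n + j).choose n * (n + 1 + j) ^ (-s)`, which is
comparable to `(n + 1 + j) ^ (n - s)`. -/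
theorem tsum_rpow_lt_top_iff (n : ℕ) (s : ℝ) :
    ∑' p : (Σ _ : ℕ, Fin n → ℕ), ENNReal.ofReal |(n : ℝ) + 1 + (p.1 + ∑ i, p.2 i : ℕ)| ^ (-s) < ∞
      ↔ (n : ℝ) + 1 < s := by
  rw [tsum_sigma_nat_pi_eq n fun j => ENNReal.ofReal |(n : ℝ) + 1 + (j : ℕ)| ^ (-s)]
  have hpos : ∀ j : ℕ, (0 : ℝ) < n + 1 + j := fun j => by positivity
  set g : ℕ → ℝ := fun j => ((n + j).choose n : ℝ) * ((n : ℝ) + 1 + j) ^ (-s) with hg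
  have hg0 : ∀ j, 0 ≤ g j := fun j => by positivity
  have h1 : ∀ j, ((n + j).choose n : ℝ≥0∞) * ENNReal.ofReal |(n : ℝ) + 1 + (j : ℕ)| ^ (-s)
      = ENNReal.ofReal (g j) := fun j => by
    rw [hg, ENNReal.ofReal_mul (by positivity), abs_of_pos (hpos j),
      ENNReal.ofReal_rpow_of_pos (hpos j), ENNReal.ofReal_natCast]
  have h2 : ∑' j, ENNReal.ofReal (g j) < ∞ ↔ Summable g := by
    refine ⟨fun h => ?_, fun h => h.tsum_ofReal_lt_top⟩
    exact (ENNReal.summable_toReal h.ne).congr fun j => ENNReal.toReal_ofReal (hg0 j)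
  have h3 : ∀ j : ℕ,
      ((n : ℝ) + 1 + j) ^ (n - s) = ((n : ℝ) + 1 + j) ^ n * ((n : ℝ) + 1 + j) ^ (-s) :=
    fun j => by rw [sub_eq_add_neg, Real.rpow_add (hpos j), Real.rpow_natCast]
  have h4 : Summable (fun j : ℕ => ((n : ℝ) + 1 + j) ^ (n - s)) ↔ (n : ℝ) + 1 < s := by
    have := (summable_nat_add_iff (f := fun j : ℕ => (j : ℝ) ^ ((n : ℝ) - s)) (n + 1)).trans
      Real.summable_nat_rpow
    rw [show (n : ℝ) + 1 < s ↔ (n : ℝ) - s < -1 by constructor <;> intro h <;> linarith, ← this]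
    refine summable_congr fun j => ?_
    push_cast
    ring_nf
  simp only [h1]
  rw [h2, ← h4]
  constructor
  · intro h
    refine Summable.of_nonneg_of_le (fun j => by positivity) (fun j => ?_)
      (h.mul_left ((n + 1 : ℝ) ^ n * n.factorial))
    have h5 : ((j : ℝ) + 1) ^ n / n.factorial ≤ ((n + j).choose n : ℝ) := by
      have := Nat.pow_le_choose (α := ℝ) n (n + j)
      rw [show n + j + 1 - n = j + 1 by omega] at this
      exact_mod_cast this
    rw [div_le_iff₀ (by positivity)] at h5
    have h6 : ((n : ℝ) + 1 + j) ^ n ≤ (n + 1 : ℝ) ^ n * ((j : ℝ) + 1) ^ n := by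
      rw [← mul_pow]
      refine pow_le_pow_left₀ (hpos j).le ?_ n
      nlinarith [mul_nonneg (Nat.cast_nonneg (α := ℝ) n) (Nat.cast_nonneg (α := ℝ) j)]
    rw [h3, hg]
    have h7 : (0 : ℝ) ≤ ((n : ℝ) + 1 + j) ^ (-s) := by positivity
    calc _ ≤ ((n + 1 : ℝ) ^ n * (((n + j).choose n : ℝ) * n.factorial)) *
            ((n : ℝ) + 1 + j) ^ (-s) := by
          gcongr
          exact h6.trans (by gcongr)
      _ = _ := by ring
  · intro h
    refine Summable.of_nonneg_of_le hg0 (fun j => ?_) h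
    rw [h3, hg]
    dsimp only
    gcongr
    refine (Nat.choose_le_pow_div (α := ℝ) n (n + j)).trans ?_
    refine (div_le_self (by positivity)
      (by exact_mod_cast Nat.one_le_iff_ne_zero.2 n.factorial_ne_zero)).trans ?_
    refine pow_le_pow_left₀ (by positivity) ?_ n
    push_cast
    linarith

theorem tendsto_eigenvalue_cofinite (n : ℕ) :
    Tendsto (fun p : (Σ _ : ℕ, Fin n → ℕ) => |(n : ℝ) + 1 + (p.1 + ∑ i, p.2 i : ℕ)|)
      cofinite atTop := by
  have h1 : Tendsto (fun p : (Σ _ : ℕ, Fin n → ℕ) => p.1 + ∑ i, p.2 i) cofinite atTop := by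
    refine tendsto_atTop.2 fun N => ?_
    rw [eventually_cofinite]
    have hfin : (Set.Iic N ×ˢ Set.Iic (fun _ : Fin n => N)).Finite :=
      (Set.finite_Iic N).prod (Set.finite_Iic _)
    refine (hfin.preimage (f := Equiv.sigmaEquivProd ℕ (Fin n → ℕ))
      (Equiv.injective _).injOn).subset fun p hp => ?_
    have hp' : p.1 + ∑ i, p.2 i < N := not_le.1 hp
    refine ⟨?_, fun i => ?_⟩
    · change p.1 ≤ N
      omega
    · have := Finset.single_le_sum (f := p.2) (fun _ _ => Nat.zero_le _) (Finset.mem_univ i)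
      change p.2 i ≤ N
      omega
  refine tendsto_abs_atTop_atTop.comp ?_
  exact tendsto_atTop_add_const_left _ _ (tendsto_natCast_atTop_atTop.comp h1)

end Counting

end SpectralTriple

namespace BergmanTriple

open ComplexConjugate

/-! ### The torus action on the ball -/

section Torus

variable {n : ℕ}

/-- The action of the torus on `ℂⁿ` by coordinatewise multiplication. -/
def torusAct (u : Fin n → Circle) : Cn n ≃ₗᵢ[ℝ] Cn n :=
  LinearIsometryEquiv.piLpCongrRight 2 fun i => (rotation (u i) : ℂ ≃ₗᵢ[ℝ] ℂ)

@[simp]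
theorem torusAct_apply (u : Fin n → Circle) (z : Cn n) (i : Fin n) :
    torusAct u z i = (u i : ℂ) * z i := rfl

theorem differentiable_torusAct (u : Fin n → Circle) :
    Differentiable ℂ (fun z : Cn n => torusAct u z) := by
  rw [differentiable_euclidean]
  intro i
  simp only [torusAct_apply]
  fun_prop

theorem torusAct_mem_unitBall (u : Fin n → Circle) {z : Cn n} :
    torusAct u z ∈ unitBall n ↔ z ∈ unitBall n := by
  simp [unitBall]

theorem measurePreserving_torusAct (m : ℕ) (u : Fin n → Circle) :
    MeasurePreserving (torusAct u) (weightedMeasure n m) (weightedMeasure n m) := by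
  have h0 : MeasurePreserving (torusAct u) (ballMeasure n) (ballMeasure n) := by
    have h1 := (torusAct u).measurePreserving.restrict_preimage
      (Metric.isOpen_ball (x := (0 : Cn n)) (ε := 1)).measurableSet
    have h2 : torusAct u ⁻¹' Metric.ball 0 1 = Metric.ball 0 1 := by
      ext z
      simp
    rw [h2] at h1
    exact h1.smul_measure _
  refine ⟨h0.measurable, ?_⟩
  ext A hA
  have hm : Measurable fun z : Cn n => ENNReal.ofReal ((1 - ‖z‖ ^ 2) ^ m) := by fun_prop
  rw [Measure.map_apply h0.measurable hA, weightedMeasure,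
    withDensity_apply _ (h0.measurable hA), withDensity_apply _ hA,
    ← h0.setLIntegral_comp_preimage hA hm]
  simp

/-- The character of the torus with exponent `w`. -/
def torusChar (w : Fin n → ℤ) (u : Fin n → Circle) : ℂ := ∏ j, (u j : ℂ) ^ w j

theorem torusChar_add (w w' : Fin n → ℤ) (u : Fin n → Circle) :
    torusChar (w + w') u = torusChar w u * torusChar w' u := by
  rw [torusChar, torusChar, torusChar, ← Finset.prod_mul_distrib]
  exact Finset.prod_congr rfl fun j _ => zpow_add₀ (Circle.coe_ne_zero _) _ _

theorem torusChar_neg (w : Fin n → ℤ) (u : Fin n → Circle) :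
    torusChar (-w) u = conj (torusChar w u) := by
  simp only [torusChar, map_prod, map_zpow₀, ← Circle.coe_inv_eq_conj, Circle.coe_inv, inv_zpow,
    Pi.neg_apply, zpow_neg]

/-- Restriction of a character to the circle subgroup acting on the coordinate `j`. -/
theorem torusChar_update (w : Fin n → ℤ) (j : Fin n) (c : Circle) :
    torusChar w (Function.update 1 j c) = (c : ℂ) ^ w j := by
  rw [torusChar, Finset.prod_eq_single j]
  · simp
  · intro i _ hi
    simp [Function.update_of_ne hi]
  · simp

theorem torusChar_const (w : Fin n → ℤ) (c : Circle) :
    torusChar w (fun _ => c) = (c : ℂ) ^ ∑ j, w j := by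
  classical
  rw [torusChar]
  induction (Finset.univ : Finset (Fin n)) using Finset.induction_on with
  | empty => simp
  | insert j s hj ih =>
    rw [Finset.prod_insert hj, Finset.sum_insert hj, ih, zpow_add₀ (Circle.coe_ne_zero _)]

theorem exists_torusChar_ne_one {w : Fin n → ℤ} (hw : w ≠ 0) : ∃ u, torusChar w u ≠ 1 := by
  obtain ⟨j, hj⟩ := Function.ne_iff.1 hw
  refine ⟨Function.update 1 j (Circle.exp (Real.pi / w j)), ?_⟩
  have hj' : (w j : ℂ) ≠ 0 := by exact_mod_cast hj
  -- the value of the character at this point is `exp (iπ) = -1`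
  rw [torusChar_update, Circle.coe_exp, ← Complex.exp_int_mul]
  have : (w j : ℂ) * ((Real.pi / w j : ℝ) * Complex.I) = Real.pi * Complex.I := by
    push_cast
    field_simp
  rw [this, Complex.exp_pi_mul_I]
  norm_num

/-- Functions which transform under the torus by the character with exponent `w`. -/
def IsWeight (w : Fin n → ℤ) (f : Cn n → ℂ) : Prop :=
  ∀ u z, f (torusAct u z) = torusChar w u * f z

namespace IsWeight

variable {w w' : Fin n → ℤ} {f g : Cn n → ℂ}

theorem mul (hf : IsWeight w f) (hg : IsWeight w' g) : IsWeight (w + w') fun z => f z * g z :=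
  fun u z => by
    dsimp only
    rw [hf, hg, torusChar_add]
    ring

theorem conjugate (hf : IsWeight w f) : IsWeight (-w) fun z => conj (f z) := fun u z => by
  dsimp only
  rw [hf, torusChar_neg, map_mul]

/-- Orthogonality relations: a function of nonzero weight has integral zero. -/
theorem integral_eq_zero (m : ℕ) (hf : IsWeight w f) (hw : w ≠ 0) :
    ∫ z, f z ∂weightedMeasure n m = 0 := by
  obtain ⟨u, hu⟩ := exists_torusChar_ne_one hw
  have h1 := (measurePreserving_torusAct m u).integral_comp
    (torusAct u).toHomeomorph.measurableEmbedding f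
  simp only [hf u, integral_const_mul] at h1
  rw [← sub_eq_zero, ← sub_one_mul, mul_eq_zero] at h1
  exact h1.resolve_left (sub_ne_zero.2 hu)

end IsWeight

theorem isWeight_coord (j : Fin n) : IsWeight (Pi.single j 1) (coord n j) := fun u z => by
  change torusAct u z j = _ * z j
  rw [torusAct_apply, torusChar, Finset.prod_eq_single j]
  · simp
  · intro i _ hi
    simp [hi]
  · simp

/-- Polynomials are sums of polynomials of definite weight. -/
theorem polynomials_le_span_isWeight {p : C(Cn n, ℂ)} (hp : p ∈ polynomials n) :
    p ∈ Submodule.span ℂ {f : C(Cn n, ℂ) | f ∈ polynomials n ∧ ∃ w, IsWeight w f} := by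
  set S := {f : C(Cn n, ℂ) | f ∈ polynomials n ∧ ∃ w, IsWeight w f}
  have hone : (1 : C(Cn n, ℂ)) ∈ S := ⟨one_mem _, 0, fun u z => by simp [torusChar]⟩
  induction hp using StarAlgebra.adjoin_induction with
  | mem f hf =>
    obtain ⟨j, rfl⟩ := hf
    exact Submodule.subset_span
      ⟨StarAlgebra.subset_adjoin _ _ ⟨j, rfl⟩, Pi.single j 1, isWeight_coord j⟩
  | algebraMap c =>
    rw [Algebra.algebraMap_eq_smul_one]
    exact Submodule.smul_mem _ _ (Submodule.subset_span hone)
  | add f g _ _ hf hg => exact add_mem hf hg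
  | mul f g _ _ hf hg =>
    have h1 := Submodule.mul_mem_mul hf hg
    rw [Submodule.span_mul_span] at h1
    refine Submodule.span_mono ?_ h1
    rintro _ ⟨a, ⟨ha, w, hw⟩, b, ⟨hb, w', hw'⟩, rfl⟩
    exact ⟨mul_mem ha hb, w + w', hw.mul hw'⟩
  | star f _ hf =>
    refine Submodule.span_induction (p := fun f _ => star f ∈ Submodule.span ℂ S) ?_ ?_ ?_ ?_ hf
    · rintro a ⟨ha, w, hw⟩
      exact Submodule.subset_span ⟨star_mem ha, -w, hw.conjugate⟩
    · simp
    · intro a b _ _ ha hb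
      rw [star_add]
      exact add_mem ha hb
    · intro c a _ ha
      rw [star_smul]
      exact Submodule.smul_mem _ _ ha

end Torus

/-! ### Monomials and matrix entries of Toeplitz operators -/

section Monomials

variable {n : ℕ}

/-- The holomorphic monomial `z ↦ z^β`. -/
def monomialFun (β : Fin n → ℕ) : C(Cn n, ℂ) where
  toFun z := ∏ j, z j ^ β j
  continuous_toFun := by fun_prop

theorem monomialFun_apply (β : Fin n → ℕ) (z : Cn n) : monomialFun β z = ∏ j, z j ^ β j := rfl

theorem isWeight_monomialFun (β : Fin n → ℕ) : IsWeight (fun j => (β j : ℤ)) (monomialFun β) :=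
  fun u z => by
    simp only [monomialFun_apply, torusChar, torusAct_apply, mul_pow, Finset.prod_mul_distrib,
      zpow_natCast]

theorem differentiable_monomialFun (β : Fin n → ℕ) : Differentiable ℂ (monomialFun β) := by
  have : (monomialFun β : Cn n → ℂ) = fun z => ∏ j, z j ^ β j := rfl
  rw [this]
  fun_prop

theorem memLp_symbol (m : ℕ) (f : C(Cn n, ℂ)) : MemLp f 2 (weightedMeasure n m) :=
  (memLp_top_symbol m f).mono_exponent le_top

/-- The holomorphic monomial `z^β` as an element of the weighted Bergman space. -/
def monomial (m : ℕ) (β : Fin n → ℕ) : BergmanSpace n m :=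
  (⟨(memLp_symbol m (monomialFun β)).toLp, monomialFun β,
    (differentiable_monomialFun β).differentiableOn, MemLp.coeFn_toLp _⟩ : bergman n m)

theorem incl_monomial_ae (m : ℕ) (β : Fin n → ℕ) :
    incl n m (monomial m β) =ᵐ[weightedMeasure n m] monomialFun β :=
  (memLp_symbol m (monomialFun β)).coeFn_toLp

theorem inner_toeplitz (m : ℕ) (f : C(Cn n, ℂ)) (φ ψ : BergmanSpace n m) :
    inner ℂ φ (toeplitz n m f ψ)
      = ∫ z, f z * incl n m ψ z * conj (incl n m φ z) ∂weightedMeasure n m := by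
  simp only [toeplitz, ContinuousLinearMap.comp_apply]
  rw [← inner_incl_left, L2.inner_def]
  refine integral_congr_ae ?_
  filter_upwards [mulOp_ae n m f (incl n m ψ)] with z hz
  rw [hz, RCLike.inner_apply]

theorem inner_eq_integral (m : ℕ) (φ ψ : BergmanSpace n m) :
    inner ℂ φ ψ = ∫ z, incl n m ψ z * conj (incl n m φ z) ∂weightedMeasure n m := by
  change inner ℂ (incl n m φ) (incl n m ψ) = _
  rw [L2.inner_def]
  rfl

theorem inner_monomial_toeplitz (m : ℕ) (f : C(Cn n, ℂ)) (β γ : Fin n → ℕ) :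
    inner ℂ (monomial m γ) (toeplitz n m f (monomial m β))
      = ∫ z, f z * monomialFun β z * conj (monomialFun γ z) ∂weightedMeasure n m := by
  rw [inner_toeplitz]
  refine integral_congr_ae ?_
  filter_upwards [incl_monomial_ae m β, incl_monomial_ae m γ] with z h1 h2
  rw [h1, h2]

theorem inner_monomial (m : ℕ) (β γ : Fin n → ℕ) :
    inner ℂ (monomial m γ) (monomial m β)
      = ∫ z, monomialFun β z * conj (monomialFun γ z) ∂weightedMeasure n m := by
  rw [inner_eq_integral]
  refine integral_congr_ae ?_
  filter_upwards [incl_monomial_ae m β, incl_monomial_ae m γ] with z h1 h2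
  rw [h1, h2]

/-- A Toeplitz operator whose symbol has weight `w` shifts the exponents of monomials by `w`. -/
theorem inner_monomial_toeplitz_eq_zero (m : ℕ) {f : C(Cn n, ℂ)} {w : Fin n → ℤ}
    (hf : IsWeight w f) {β γ : Fin n → ℕ}
    (h : w + (fun j => (β j : ℤ)) ≠ fun j => (γ j : ℤ)) :
    inner ℂ (monomial m γ) (toeplitz n m f (monomial m β)) = 0 := by
  rw [inner_monomial_toeplitz]
  refine ((hf.mul (isWeight_monomialFun β)).mul
    (isWeight_monomialFun γ).conjugate).integral_eq_zero m ?_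
  rwa [← sub_eq_add_neg, sub_ne_zero]

theorem inner_monomial_eq_zero (m : ℕ) {β γ : Fin n → ℕ} (h : β ≠ γ) :
    inner ℂ (monomial m γ) (monomial m β) = 0 := by
  rw [inner_monomial]
  refine ((isWeight_monomialFun β).mul (isWeight_monomialFun γ).conjugate).integral_eq_zero m ?_
  rw [← sub_eq_add_neg, sub_ne_zero]
  exact fun h' => h (funext fun j => by exact_mod_cast congrFun h' j)

theorem norm_monomial_sq (m : ℕ) (β : Fin n → ℕ) :
    (‖monomial m β‖ ^ 2 : ℂ) = ((∫ z, ‖monomialFun β z‖ ^ 2 ∂weightedMeasure n m : ℝ) : ℂ) := by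
  have h := inner_self_eq_norm_sq_to_K (𝕜 := ℂ) (monomial m β)
  rw [inner_monomial] at h
  rw [← integral_complex_ofReal]
  refine h.symm.trans (integral_congr_ae (.of_forall fun z => ?_))
  dsimp only
  rw [Complex.mul_conj']
  push_cast
  rfl

end Monomials

/-! ### Norms of monomials -/

section Radial

/-- Integration in polar coordinates of a product of a radial and an angular function. -/
theorem integral_radial_mul_angular {E : Type*} [NormedAddCommGroup E] [NormedSpace ℝ E]
    [FiniteDimensional ℝ E] [Nontrivial E] [MeasurableSpace E] [BorelSpace E] (μ : Measure E)
    [μ.IsAddHaarMeasure] (h : ℝ → ℝ) (g : E → ℝ) :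
    ∫ x, g (‖x‖⁻¹ • x) * h ‖x‖ ∂μ = (∫ x : Metric.sphere (0 : E) 1, g x ∂μ.toSphere) *
      ∫ y in Set.Ioi (0 : ℝ), y ^ (Module.finrank ℝ E - 1) * h y :=
  calc
    ∫ x, g (‖x‖⁻¹ • x) * h ‖x‖ ∂μ
        = ∫ x : ({(0)}ᶜ : Set E), g (‖x.1‖⁻¹ • x.1) * h ‖x.1‖ ∂(μ.comap (↑)) := by
      rw [integral_subtype_comap (measurableSet_singleton _).compl
        fun x => g (‖x‖⁻¹ • x) * h ‖x‖, restrict_compl_singleton]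
    _ = ∫ x, g x.1 * h x.2 ∂μ.toSphere.prod (.volumeIoiPow (Module.finrank ℝ E - 1)) := by
      simpa using μ.measurePreserving_homeomorphUnitSphereProd.integral_comp
        (Homeomorph.measurableEmbedding _)
        fun x : Metric.sphere (0 : E) 1 × Set.Ioi (0 : ℝ) => g x.1 * h x.2
    _ = (∫ x : Metric.sphere (0 : E) 1, g x ∂μ.toSphere) *
          ∫ x : Set.Ioi (0 : ℝ), h x ∂.volumeIoiPow (Module.finrank ℝ E - 1) :=
      integral_prod_mul (fun x : Metric.sphere (0 : E) 1 => g x) fun x : Set.Ioi (0 : ℝ) => h x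
    _ = _ := by
      congr 1
      simp only [Measure.volumeIoiPow, ENNReal.ofReal]
      rw [integral_withDensity_eq_integral_smul,
        integral_subtype_comap measurableSet_Ioi
          fun a => Real.toNNReal (a ^ (Module.finrank ℝ E - 1)) • h a,
        setIntegral_congr_fun measurableSet_Ioi fun x hx => ?_]
      · rw [NNReal.smul_def, Real.coe_toNNReal _ (pow_nonneg hx.out.le _), smul_eq_mul]
      · exact (measurable_subtype_coe.pow_const _).real_toNNReal

/-- Recurrence for the radial integrals, from integration by parts. -/
theorem radial_integral_succ (p m : ℕ) :
    ((p : ℝ) + 1 + 2 * (m + 1)) * ∫ r in (0 : ℝ)..1, r ^ p * (1 - r ^ 2) ^ (m + 1)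
      = 2 * (m + 1) * ∫ r in (0 : ℝ)..1, r ^ p * (1 - r ^ 2) ^ m := by
  have hd : ∀ r ∈ Set.uIcc (0 : ℝ) 1,
      HasDerivAt (fun r : ℝ => r ^ (p + 1) * (1 - r ^ 2) ^ (m + 1))
      (((p : ℝ) + 1 + 2 * (m + 1)) * (r ^ p * (1 - r ^ 2) ^ (m + 1))
        - 2 * (m + 1) * (r ^ p * (1 - r ^ 2) ^ m)) r := by
    intro r _
    have h1 := (hasDerivAt_pow (p + 1) r).mul
      ((((hasDerivAt_pow 2 r).const_sub 1)).pow (m + 1))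
    refine h1.congr_deriv ?_
    simp only [Pi.pow_apply]
    push_cast
    ring
  have h2 := intervalIntegral.integral_eq_sub_of_hasDerivAt hd
    (Continuous.intervalIntegrable (by fun_prop) _ _)
  rw [intervalIntegral.integral_sub (Continuous.intervalIntegrable (by fun_prop) _ _)
    (Continuous.intervalIntegrable (by fun_prop) _ _), intervalIntegral.integral_const_mul,
    intervalIntegral.integral_const_mul] at h2
  rw [← sub_eq_zero, h2]
  simp

variable {n : ℕ}

theorem integral_weightedMeasure (m : ℕ) (f : Cn n → ℝ) :
    ∫ z, f z ∂weightedMeasure n m = (volume (unitBall n))⁻¹.toReal *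
      ∫ z : Cn n, f z * (Set.Iio 1).indicator (fun t : ℝ => (1 - t ^ 2) ^ m) ‖z‖ := by
  rw [weightedMeasure, integral_withDensity_eq_integral_toReal_smul₀ (by fun_prop) (by simp),
    ballMeasure, integral_smul_measure, smul_eq_mul,
    ← integral_indicator (s := unitBall n) Metric.isOpen_ball.measurableSet]
  congr 1
  refine integral_congr_ae (.of_forall fun z => ?_)
  by_cases hz : ‖z‖ < 1
  · have h1 : (0 : ℝ) ≤ (1 - ‖z‖ ^ 2) ^ m := pow_nonneg (by nlinarith [norm_nonneg z]) m
    have hz' : z ∈ unitBall n := by simpa [unitBall] using hz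
    dsimp only
    rw [Set.indicator_of_mem hz', Set.indicator_of_mem (Set.mem_Iio.2 hz), smul_eq_mul,
      ENNReal.toReal_ofReal h1, mul_comm]
  · have hz' : z ∉ unitBall n := by simpa [unitBall] using hz
    dsimp only
    rw [Set.indicator_of_notMem hz', Set.indicator_of_notMem (by simpa using hz), mul_zero]

/-- The weighted integral of `|z^β|²` is the product of a factor depending only on `β` and of a
one-dimensional integral. -/
theorem exists_integral_weightedMeasure_eq (hn : 1 ≤ n) (β : Fin n → ℕ) :
    ∃ c : ℝ, ∀ m : ℕ, ∫ z : Cn n, ‖monomialFun β z‖ ^ 2 *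
        (Set.Iio 1).indicator (fun t : ℝ => (1 - t ^ 2) ^ m) ‖z‖
      = c * ∫ r in (0 : ℝ)..1, r ^ (2 * n - 1 + 2 * ∑ j, β j) * (1 - r ^ 2) ^ m := by
  have : Nonempty (Fin n) := ⟨⟨0, hn⟩⟩
  have hfr : Module.finrank ℝ (Cn n) = 2 * n := by
    rw [← Module.finrank_mul_finrank ℝ ℂ (Cn n), Complex.finrank_real_complex,
      finrank_euclideanSpace_fin]
  set k := ∑ j, β j with hk
  refine ⟨∫ x : Metric.sphere (0 : Cn n) 1, ‖monomialFun β x‖ ^ 2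
    ∂(volume : Measure (Cn n)).toSphere, fun m => ?_⟩
  have hhom : ∀ z : Cn n, z ≠ 0 → ‖monomialFun β z‖ ^ 2
      = ‖monomialFun β (‖z‖⁻¹ • z)‖ ^ 2 * ‖z‖ ^ (2 * k) := by
    intro z hz
    have hz' : ‖z‖ ≠ 0 := norm_ne_zero_iff.2 hz
    have h1 : ‖monomialFun β (‖z‖⁻¹ • z)‖ = (‖z‖⁻¹) ^ k * ‖monomialFun β z‖ := by
      simp only [monomialFun_apply, PiLp.smul_apply, norm_prod, norm_pow, norm_smul, norm_inv,
        norm_norm, mul_pow, Finset.prod_mul_distrib, Finset.prod_pow_eq_pow_sum, ← hk]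
    rw [h1, mul_pow, ← pow_mul, mul_comm k 2, inv_pow]
    field_simp
  have h1 := integral_radial_mul_angular (volume : Measure (Cn n))
    (fun t => t ^ (2 * k) * (Set.Iio 1).indicator (fun t : ℝ => (1 - t ^ 2) ^ m) t)
    (fun z => ‖monomialFun β z‖ ^ 2)
  have hae : ∀ᵐ z : Cn n, z ≠ 0 := Measure.ae_ne volume 0
  rw [integral_congr_ae (g := fun z : Cn n => ‖monomialFun β (‖z‖⁻¹ • z)‖ ^ 2 *
    (‖z‖ ^ (2 * k) * (Set.Iio 1).indicator (fun t : ℝ => (1 - t ^ 2) ^ m) ‖z‖)), h1]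
  · congr 1
    have h2 : ∀ y : ℝ, y ^ (2 * n - 1) * (y ^ (2 * k) *
          (Set.Iio 1).indicator (fun t : ℝ => (1 - t ^ 2) ^ m) y)
        = (Set.Iio 1).indicator (fun t : ℝ => t ^ (2 * n - 1 + 2 * k) * (1 - t ^ 2) ^ m) y := by
      intro y
      by_cases hy : y ∈ Set.Iio (1 : ℝ)
      · rw [Set.indicator_of_mem hy, Set.indicator_of_mem hy, pow_add, mul_assoc]
      · rw [Set.indicator_of_notMem hy, Set.indicator_of_notMem hy, mul_zero, mul_zero]
    simp only [hfr, h2]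
    rw [setIntegral_indicator measurableSet_Iio, Set.Ioi_inter_Iio,
      intervalIntegral.integral_of_le zero_le_one, integral_Ioc_eq_integral_Ioo]
  · filter_upwards [hae] with z hz
    rw [hhom z hz, mul_assoc]

/-- Multiplying the weight by `-r` multiplies the squared norm of `z^β` by
`(m + 1) / (n + m + 1 + |β|)`, the eigenvalue of `T_{-r}` on `z^β`. -/
theorem integral_norm_monomial_succ (hn : 1 ≤ n) (m : ℕ) (β : Fin n → ℕ) :
    ((n : ℝ) + m + 1 + (∑ j, β j : ℕ)) *
        ∫ z, (1 - ‖z‖ ^ 2) * ‖monomialFun β z‖ ^ 2 ∂weightedMeasure n m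
      = (m + 1) * ∫ z, ‖monomialFun β z‖ ^ 2 ∂weightedMeasure n m := by
  obtain ⟨c, hc⟩ := exists_integral_weightedMeasure_eq hn β
  have h1 : ∀ z : Cn n, (1 - ‖z‖ ^ 2) * ‖monomialFun β z‖ ^ 2 *
      (Set.Iio 1).indicator (fun t : ℝ => (1 - t ^ 2) ^ m) ‖z‖
      = ‖monomialFun β z‖ ^ 2 * (Set.Iio 1).indicator (fun t : ℝ => (1 - t ^ 2) ^ (m + 1)) ‖z‖ := by
    intro z
    by_cases hz : ‖z‖ < 1
    · rw [Set.indicator_of_mem (Set.mem_Iio.2 hz), Set.indicator_of_mem (Set.mem_Iio.2 hz)]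
      ring
    · rw [Set.indicator_of_notMem (by simpa using hz), Set.indicator_of_notMem (by simpa using hz)]
      ring
  rw [integral_weightedMeasure, integral_weightedMeasure]
  simp only [h1, hc]
  have h2 := radial_integral_succ (2 * n - 1 + 2 * ∑ j, β j) m
  have h3 : ((2 * n - 1 + 2 * ∑ j, β j : ℕ) : ℝ) = 2 * n - 1 + 2 * (∑ j, β j : ℕ) := by
    rw [Nat.cast_add, Nat.cast_sub (by omega)]
    push_cast
    ring
  rw [h3] at h2
  linear_combination ((volume (unitBall n))⁻¹.toReal * c / 2) * h2

end Radial

/-! ### Holomorphic functions of definite weight -/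

section Holomorphic

/-- By the maximum principle, a holomorphic function which is homogeneous of degree `k` on a circle
is a monomial. -/
theorem mul_pow_eq_of_circle {g : ℂ → ℂ} {r : ℝ} (hr : 0 < r)
    (hg : DifferentiableOn ℂ g (Metric.closedBall 0 r)) {k : ℕ}
    (hk : ∀ c : Circle, g (c * r) = (c : ℂ) ^ k * g r) {ζ : ℂ} (hζ : ‖ζ‖ ≤ r) :
    g ζ * r ^ k = g r * ζ ^ k := by
  have hcl : closure (Metric.ball (0 : ℂ) r) = Metric.closedBall 0 r := closure_ball _ hr.ne'
  have h1 : DiffContOnCl ℂ (fun ζ => g ζ * r ^ k) (Metric.ball 0 r) :=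
    DifferentiableOn.diffContOnCl (by rw [hcl]; exact hg.mul_const _)
  have h2 : DiffContOnCl ℂ (fun ζ => g r * ζ ^ k) (Metric.ball 0 r) :=
    DifferentiableOn.diffContOnCl (by fun_prop)
  refine Complex.eqOn_closure_of_eqOn_frontier Metric.isBounded_ball h1 h2 ?_
    (by rw [hcl]; simpa using hζ)
  rw [frontier_ball _ hr.ne']
  intro ξ hξ
  have hξ' : ‖ξ‖ = r := by simpa using hξ
  have hr' : (r : ℂ) ≠ 0 := by exact_mod_cast hr.ne'
  obtain ⟨c, hc⟩ : ∃ c : Circle, ξ = c * r := by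
    refine ⟨⟨ξ / r, ?_⟩, (div_mul_cancel₀ _ hr').symm⟩
    change ξ / r ∈ Metric.sphere (0 : ℂ) 1
    rw [mem_sphere_zero_iff_norm, norm_div, hξ', Complex.norm_of_nonneg hr.le, div_self hr.ne']
  dsimp only
  rw [hc, hk]
  ring

/-- A holomorphic function which is homogeneous of negative degree on a circle vanishes. -/
theorem eq_zero_of_circle {g : ℂ → ℂ} {r : ℝ} (hr : 0 < r)
    (hg : DifferentiableOn ℂ g (Metric.closedBall 0 r)) {k : ℤ} (hk0 : k < 0)
    (hk : ∀ c : Circle, g (c * r) = (c : ℂ) ^ k * g r) {ζ : ℂ} (hζ : ‖ζ‖ ≤ r) : g ζ = 0 := by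
  obtain ⟨l, rfl⟩ := Int.eq_negSucc_of_lt_zero hk0
  have hr' : (r : ℂ) ≠ 0 := by exact_mod_cast hr.ne'
  -- `ζ ^ (l + 1) * g ζ` is homogeneous of degree zero, hence constant, and vanishes at the origin
  have h1 := mul_pow_eq_of_circle (g := fun ζ => ζ ^ (l + 1) * g ζ) (k := 0) hr (by fun_prop)
    (fun c => by
      rw [hk, zpow_negSucc, mul_pow, pow_zero, one_mul]
      field_simp [Circle.coe_ne_zero c]) (ζ := 0) (by simpa using hr.le)
  simp only [pow_zero, mul_one, ne_eq, Nat.add_eq_zero_iff, one_ne_zero, and_false,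
    not_false_eq_true, zero_pow, zero_mul, zero_eq_mul, pow_eq_zero_iff, hr', false_or] at h1
  have h2 := mul_pow_eq_of_circle (k := 0) hr hg (fun c => by rw [hk, h1]; ring) hζ
  simpa [h1] using h2

variable {n : ℕ}

/-- A holomorphic function on the ball which transforms under the torus by a character is a multiple
of a monomial. -/
theorem exists_eq_const_mul_monomialFun {G : Cn n → ℂ} (hG : DifferentiableOn ℂ G (unitBall n))
    {w : Fin n → ℤ}
    (hw : ∀ u, ∀ z ∈ unitBall n, G (torusAct u z) = torusChar w u * G z) :
    ∃ (β : Fin n → ℕ) (c : ℂ), ∀ z ∈ unitBall n, G z = c * monomialFun β z := by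
  -- a closed polydisc contained in the ball
  set ρ : ℝ := 1 / (n + 1) with hρ
  have hρ0 : 0 < ρ := by positivity
  have hρ1 : ρ ≤ 1 := by
    rw [hρ, div_le_one (by positivity)]
    linarith [(Nat.cast_nonneg n : (0 : ℝ) ≤ n)]
  have hnρ : n * ρ ^ 2 < 1 := by
    rw [hρ, one_div, inv_pow, ← div_eq_mul_inv, div_lt_one (by positivity)]
    nlinarith [(Nat.cast_nonneg n : (0 : ℝ) ≤ n)]
  have hP : ∀ x : Fin n → ℂ, (∀ i, ‖x i‖ ≤ ρ) → WithLp.toLp 2 x ∈ unitBall n := by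
    intro x hx
    have h1 : ‖(WithLp.toLp 2 x : Cn n)‖ ^ 2 ≤ n * ρ ^ 2 := by
      rw [EuclideanSpace.norm_sq_eq]
      refine (Finset.sum_le_sum fun i _ => pow_le_pow_left₀ (norm_nonneg _) (hx i) 2).trans ?_
      simp
    have h2 : ‖(WithLp.toLp 2 x : Cn n)‖ < 1 := by
      nlinarith [norm_nonneg (WithLp.toLp 2 x : Cn n)]
    simpa [unitBall] using h2
  have hupd : ∀ (x : Fin n → ℂ) (j : Fin n), (∀ i, ‖x i‖ ≤ ρ) → ∀ ζ : ℂ, ‖ζ‖ ≤ ρ →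
      ∀ i, ‖Function.update x j ζ i‖ ≤ ρ := by
    intro x j hx ζ hζ i
    rcases eq_or_ne i j with rfl | hi
    · simpa using hζ
    · simpa [Function.update_of_ne hi] using hx i
  have hslice : ∀ (x : Fin n → ℂ) (j : Fin n), (∀ i, ‖x i‖ ≤ ρ) →
      DifferentiableOn ℂ (fun ζ : ℂ => G (WithLp.toLp 2 (Function.update x j ζ)))
        (Metric.closedBall 0 ρ) := by
    intro x j hx
    refine hG.comp ?_ fun ζ hζ => hP _ (hupd x j hx ζ (by simpa using hζ))
    have h1 : Differentiable ℂ fun ζ : ℂ => (WithLp.toLp 2 (Function.update x j ζ) : Cn n) := by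
      rw [differentiable_euclidean]
      intro i
      exact differentiable_pi.1 (fun ζ => (hasDerivAt_update x j ζ).differentiableAt) i
    exact h1.differentiableOn
  have hcirc : ∀ (x : Fin n → ℂ) (j : Fin n), (∀ i, ‖x i‖ ≤ ρ) → ∀ c : Circle,
      G (WithLp.toLp 2 (Function.update x j (c * ρ)))
        = (c : ℂ) ^ w j * G (WithLp.toLp 2 (Function.update x j ρ)) := by
    intro x j hx c
    rw [← torusChar_update w j c,
      ← hw _ _ (hP _ (hupd x j hx ρ (by rw [Complex.norm_of_nonneg hρ0.le])))]
    congr 1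
    ext i
    rw [torusAct_apply]
    rcases eq_or_ne i j with rfl | hi
    · simp
    · simp [Function.update_of_ne hi]
  have hrad : ∀ z ∈ unitBall n, DifferentiableOn ℂ (fun ζ : ℂ => G (ζ • z))
      (Metric.closedBall 0 (1 : ℝ)) := by
    intro z hz
    refine hG.comp (by fun_prop) fun ζ hζ => ?_
    have h1 : ‖z‖ < 1 := by simpa [unitBall] using hz
    have h2 : ‖ζ‖ ≤ 1 := by simpa using hζ
    have h3 : ‖ζ • z‖ < 1 := by
      rw [norm_smul]
      nlinarith [norm_nonneg z]
    simpa [unitBall] using h3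
  have hradc : ∀ z ∈ unitBall n, ∀ c : Circle,
      G (((c : ℂ) * (1 : ℝ)) • z) = (c : ℂ) ^ (∑ j, w j) * G (((1 : ℝ) : ℂ) • z) := by
    intro z hz c
    rw [← torusChar_const]
    simp only [Complex.ofReal_one, mul_one, one_smul]
    rw [← hw _ z hz]
    congr 1
  have hz1 : ∀ z ∈ unitBall n, ∀ i, ‖z i‖ ≤ 1 := fun z hz i => by
    have h1 : ‖z‖ < 1 := by simpa [unitBall] using hz
    exact (PiLp.norm_apply_le z i).trans h1.le
  -- along complex lines `G` is homogeneous of degree `∑ j, w j`, which extends identities from the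
  -- polydisc to the ball
  rcases lt_or_ge (∑ j, w j) 0 with hneg | hnonneg
  · refine ⟨0, 0, fun z hz => ?_⟩
    have h1 := eq_zero_of_circle one_pos (hrad z hz) hneg (hradc z hz) (ζ := 1) (by simp)
    simpa using h1
  obtain ⟨k, hk⟩ := Int.eq_ofNat_of_zero_le hnonneg
  have hρc : (ρ : ℂ) ≠ 0 := by exact_mod_cast hρ0.ne'
  have hscale : ∀ z ∈ unitBall n, G ((ρ : ℂ) • z) = G z * ρ ^ k := by
    intro z hz
    have h1 := mul_pow_eq_of_circle (k := k) one_pos (hrad z hz)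
      (fun c => by rw [hradc z hz, hk, zpow_natCast]) (ζ := ρ)
      (by rw [Complex.norm_of_nonneg hρ0.le]; exact hρ1)
    simpa using h1
  have hmem : ∀ z ∈ unitBall n, ∀ i, ‖((ρ : ℂ) • z : Cn n) i‖ ≤ ρ := by
    intro z hz i
    rw [PiLp.smul_apply, norm_smul, Complex.norm_of_nonneg hρ0.le]
    exact mul_le_of_le_one_right hρ0.le (hz1 z hz i)
  by_cases hall : ∀ j, 0 ≤ w j
  · choose β hβ using fun j => Int.eq_ofNat_of_zero_le (hall j)
    have hkβ : k = ∑ j, β j := by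
      have : (k : ℤ) = ((∑ j, β j : ℕ) : ℤ) := by
        rw [← hk]
        push_cast
        exact Finset.sum_congr rfl fun j _ => hβ j
      exact_mod_cast this
    -- freeze the coordinates in `s` at the value `ρ`, one after the other
    have hind : ∀ s : Finset (Fin n), ∀ x : Fin n → ℂ, (∀ i, ‖x i‖ ≤ ρ) →
        G (WithLp.toLp 2 x) * ρ ^ (∑ j ∈ s, β j) = (∏ j ∈ s, x j ^ β j) *
          G (WithLp.toLp 2 (s.piecewise (fun _ => (ρ : ℂ)) x)) := by
      intro s
      induction s using Finset.induction_on with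
      | empty => simp
      | insert j s hj ih =>
        intro x hx
        have hy : ∀ i, ‖s.piecewise (fun _ => (ρ : ℂ)) x i‖ ≤ ρ := by
          intro i
          by_cases hi : i ∈ s
          · rw [Finset.piecewise_eq_of_mem _ _ _ hi, Complex.norm_of_nonneg hρ0.le]
          · rw [Finset.piecewise_eq_of_notMem _ _ _ hi]
            exact hx i
        have h1 := mul_pow_eq_of_circle (k := β j) hρ0 (hslice _ j hy)
          (fun c => by rw [hcirc _ j hy, hβ, zpow_natCast]) (hy j)
        rw [Function.update_eq_self, ← Finset.piecewise_insert,
          Finset.piecewise_eq_of_notMem _ _ _ hj] at h1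
        rw [Finset.sum_insert hj, Finset.prod_insert hj, pow_add]
        linear_combination (ρ : ℂ) ^ β j * ih x hx + (∏ j ∈ s, x j ^ β j) * h1
    refine ⟨β, G (WithLp.toLp 2 fun _ => (ρ : ℂ)) / ρ ^ k, fun z hz => ?_⟩
    have h1 := hind Finset.univ _ (hmem z hz)
    rw [Finset.piecewise_univ, ← hkβ, WithLp.toLp_ofLp, hscale z hz] at h1
    have h2 : ∏ j, ((ρ : ℂ) • z : Cn n) j ^ β j = ρ ^ k * monomialFun β z := by
      simp only [PiLp.smul_apply, smul_eq_mul, mul_pow, Finset.prod_mul_distrib,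
        Finset.prod_pow_eq_pow_sum, monomialFun_apply, hkβ]
    rw [h2] at h1
    have h3 : (ρ : ℂ) ^ k ≠ 0 := pow_ne_zero _ hρc
    field_simp
    refine mul_right_cancel₀ h3 ?_
    linear_combination h1
  · push Not at hall
    obtain ⟨j, hj⟩ := hall
    refine ⟨0, 0, fun z hz => ?_⟩
    have h1 := eq_zero_of_circle hρ0 (hslice _ j (hmem z hz)) hj (hcirc _ j (hmem z hz))
      (hmem z hz j)
    rw [Function.update_eq_self, WithLp.toLp_ofLp, hscale z hz] at h1
    rw [zero_mul]
    exact (mul_eq_zero.1 h1).resolve_right (pow_ne_zero _ hρc)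

end Holomorphic

/-! ### Completeness of the monomials -/

section Completeness

variable {n : ℕ}

/-- A continuous function as an element of the weighted `L²` space. -/
def symbolLp (m : ℕ) (f : C(Cn n, ℂ)) : Lp ℂ 2 (weightedMeasure n m) :=
  (memLp_symbol m f).toLp

theorem symbolLp_ae (m : ℕ) (f : C(Cn n, ℂ)) :
    symbolLp m f =ᵐ[weightedMeasure n m] f := (memLp_symbol m f).coeFn_toLp

theorem restrict_unitBall_ac_weightedMeasure (n m : ℕ) :
    volume.restrict (unitBall n) ≪ weightedMeasure n m := by
  have h1 : volume.restrict (unitBall n) ≪ ballMeasure n := by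
    rw [ballMeasure]
    exact Measure.absolutelyContinuous_smul (ENNReal.inv_ne_zero.2 (volume_unitBall_ne_top n))
  have h2 : ballMeasure n ≪ weightedMeasure n m := by
    refine withDensity_absolutelyContinuous' (by fun_prop) ?_
    have h3 : ∀ᵐ z ∂volume.restrict (unitBall n), z ∈ unitBall n :=
      ae_restrict_mem Metric.isOpen_ball.measurableSet
    filter_upwards [Measure.smul_absolutelyContinuous.ae_le h3] with z hz
    have hz' : ‖z‖ < 1 := by simpa [unitBall] using hz
    exact (ENNReal.ofReal_pos.2 (pow_pos (by nlinarith [norm_nonneg z]) m)).ne'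
  exact h1.trans h2

theorem eqOn_unitBall_of_ae_eq {m : ℕ} {F G : Cn n → ℂ} (hF : ContinuousOn F (unitBall n))
    (hG : ContinuousOn G (unitBall n)) (h : F =ᵐ[weightedMeasure n m] G) :
    Set.EqOn F G (unitBall n) :=
  Measure.eqOn_open_of_ae_eq ((restrict_unitBall_ac_weightedMeasure n m).ae_le h)
    Metric.isOpen_ball hF hG

/-- The unitary representation of the torus on the weighted `L²` space. -/
def torusLp (m : ℕ) (u : Fin n → Circle) :
    Lp ℂ 2 (weightedMeasure n m) →ₗᵢ[ℂ] Lp ℂ 2 (weightedMeasure n m) :=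
  Lp.compMeasurePreservingₗᵢ ℂ (torusAct u) (measurePreserving_torusAct m u)

theorem torusLp_ae (m : ℕ) (u : Fin n → Circle) (φ : Lp ℂ 2 (weightedMeasure n m)) :
    torusLp m u φ =ᵐ[weightedMeasure n m] fun z => φ (torusAct u z) :=
  Lp.coeFn_compMeasurePreserving φ (measurePreserving_torusAct m u)

theorem torusLp_ae_of_ae {m : ℕ} (u : Fin n → Circle) {φ : Lp ℂ 2 (weightedMeasure n m)}
    {F : Cn n → ℂ} (h : φ =ᵐ[weightedMeasure n m] F) :
    torusLp m u φ =ᵐ[weightedMeasure n m] fun z => F (torusAct u z) :=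
  (torusLp_ae m u φ).trans ((measurePreserving_torusAct m u).quasiMeasurePreserving.ae_eq_comp h)

theorem torusLp_mem_bergman {m : ℕ} (u : Fin n → Circle) {φ : Lp ℂ 2 (weightedMeasure n m)}
    (hφ : φ ∈ bergman n m) : torusLp m u φ ∈ bergman n m := by
  obtain ⟨F, hF, h⟩ := hφ
  exact ⟨fun z => F (torusAct u z), hF.comp (differentiable_torusAct u).differentiableOn
    fun z hz => (torusAct_mem_unitBall u).2 hz, torusLp_ae_of_ae u h⟩

theorem torusAct_inv_apply (u : Fin n → Circle) (z : Cn n) : torusAct u⁻¹ (torusAct u z) = z := by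
  ext i
  simp

theorem torusLp_torusLp_inv (m : ℕ) (u : Fin n → Circle) (φ : Lp ℂ 2 (weightedMeasure n m)) :
    torusLp m u (torusLp m u⁻¹ φ) = φ := by
  refine Lp.ext ((torusLp_ae_of_ae u (torusLp_ae m u⁻¹ φ)).trans (.of_forall fun z => ?_))
  dsimp only
  rw [torusAct_inv_apply]

/-- The Bergman projection commutes with the action of the torus. -/
theorem incl_proj_torusLp (m : ℕ) (u : Fin n → Circle) (φ : Lp ℂ 2 (weightedMeasure n m)) :
    incl n m (proj n m (torusLp m u φ)) = torusLp m u (incl n m (proj n m φ)) := by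
  change (bergman n m).starProjection (torusLp m u φ)
    = torusLp m u ((bergman n m).starProjection φ)
  refine Submodule.eq_starProjection_of_mem_of_inner_eq_zero
    (torusLp_mem_bergman u (Submodule.starProjection_apply_mem _ _)) fun ψ hψ => ?_
  rw [← torusLp_torusLp_inv m u ψ, ← map_sub, (torusLp m u).inner_map_map]
  exact Submodule.starProjection_inner_eq_zero φ _ (torusLp_mem_bergman u⁻¹ hψ)

/-- The Bergman projection maps functions of definite weight to multiples of monomials. -/
theorem exists_proj_eq_smul_monomial (m : ℕ) {p : C(Cn n, ℂ)} {w : Fin n → ℤ}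
    (hp : IsWeight w p) :
    ∃ (β : Fin n → ℕ) (c : ℂ), proj n m (symbolLp m p) = c • monomial m β := by
  obtain ⟨G, hG, hQ⟩ : incl n m (proj n m (symbolLp m p)) ∈ bergman n m :=
    (show bergman n m from proj n m (symbolLp m p)).2
  have hcont := hG.continuousOn
  have hU : ∀ u, torusLp m u (symbolLp m p) = torusChar w u • symbolLp m p := by
    intro u
    refine Lp.ext ((torusLp_ae_of_ae u (symbolLp_ae m p)).trans ?_)
    filter_upwards [Lp.coeFn_smul (torusChar w u) (symbolLp m p), symbolLp_ae m p] with z h1 h2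
    rw [h1, Pi.smul_apply, h2, hp u z, smul_eq_mul]
  have hw : ∀ u, ∀ z ∈ unitBall n, G (torusAct u z) = torusChar w u * G z := by
    intro u
    refine eqOn_unitBall_of_ae_eq (m := m) (hcont.comp (torusAct u).continuous.continuousOn
      fun z hz => (torusAct_mem_unitBall u).2 hz) (hcont.const_smul (torusChar w u)) ?_
    have h1 := incl_proj_torusLp m u (symbolLp m p)
    rw [hU, map_smul, map_smul] at h1
    refine (torusLp_ae_of_ae u hQ).symm.trans ?_
    rw [← h1]
    filter_upwards [Lp.coeFn_smul (torusChar w u) (incl n m (proj n m (symbolLp m p))), hQ]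
      with z h2 h3
    rw [h2, Pi.smul_apply, h3, smul_eq_mul]
  obtain ⟨β, c, hc⟩ := exists_eq_const_mul_monomialFun hG hw
  refine ⟨β, c, Subtype.ext (Lp.ext ?_)⟩
  change incl n m _ =ᵐ[weightedMeasure n m] (c • incl n m (monomial m β) : Lp ℂ 2 _)
  filter_upwards [hQ, ae_mem_unitBall n m, Lp.coeFn_smul c (incl n m (monomial m β)),
    incl_monomial_ae m β] with z h1 h2 h3 h4
  rw [h1, h3, Pi.smul_apply, h4, hc z h2, smul_eq_mul]

theorem polynomials_separatesPoints : (polynomials n).toSubalgebra.SeparatesPoints := by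
  intro z w hzw
  obtain ⟨j, hj⟩ : ∃ j, z j ≠ w j := by
    by_contra! h
    exact hzw (PiLp.ext h)
  exact ⟨coord n j, ⟨coord n j, StarAlgebra.subset_adjoin _ _ ⟨j, rfl⟩, rfl⟩, hj⟩

/-- Continuous functions are uniformly approximated by polynomials on the unit ball. -/
theorem exists_polynomial_near (f : C(Cn n, ℂ)) {ε : ℝ} (hε : 0 < ε) :
    ∃ p ∈ polynomials n, ∀ z ∈ unitBall n, ‖p z - f z‖ ≤ ε := by
  let K : Set (Cn n) := Metric.closedBall 0 1
  have : CompactSpace K := isCompact_iff_compactSpace.1 (isCompact_closedBall _ _)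
  let res : C(Cn n, ℂ) →⋆ₐ[ℂ] C(K, ℂ) :=
    ContinuousMap.compStarAlgHom' ℂ ℂ ⟨Subtype.val, continuous_subtype_val⟩
  have hsep : ((polynomials n).map res).toSubalgebra.SeparatesPoints := by
    intro z w hzw
    obtain ⟨_, ⟨g, hg, rfl⟩, hg'⟩ := polynomials_separatesPoints (Subtype.coe_ne_coe.2 hzw)
    exact ⟨res g, ⟨res g, ⟨g, hg, rfl⟩, rfl⟩, hg'⟩
  have htop := ContinuousMap.starSubalgebra_topologicalClosure_eq_top_of_separatesPoints _ hsep
  have hmem : res f ∈ ((polynomials n).map res).topologicalClosure := by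
    rw [htop]
    trivial
  obtain ⟨_, ⟨p, hp, rfl⟩, hpf⟩ := Metric.mem_closure_iff.1 hmem ε hε
  refine ⟨p, hp, fun z hz => ?_⟩
  rw [dist_comm, dist_eq_norm] at hpf
  exact ((res p - res f).norm_coe_le_norm ⟨z, Metric.ball_subset_closedBall hz⟩).trans hpf.le

theorem dense_symbolLp_polynomials (m : ℕ) :
    Dense (symbolLp m '' (polynomials n : Set C(Cn n, ℂ))) := by
  have h1 : DenseRange (BoundedContinuousFunction.toLp 2 (weightedMeasure n m) ℂ :
      BoundedContinuousFunction (Cn n) ℂ →L[ℂ] Lp ℂ 2 (weightedMeasure n m)) :=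
    BoundedContinuousFunction.toLp_denseRange _ _ _ (by norm_num)
  refine dense_closure.1 (h1.mono ?_)
  rintro _ ⟨f, rfl⟩
  rw [Metric.mem_closure_iff]
  intro ε hε
  set M : ℝ := (measureUnivNNReal (weightedMeasure n m) : ℝ) ^ (2 : ℝ≥0∞).toReal⁻¹ with hM
  have hM0 : 0 ≤ M := by positivity
  have hδ : 0 < ε / (M + 1) := by positivity
  obtain ⟨p, hp, hpf⟩ := exists_polynomial_near f.toContinuousMap hδ
  refine ⟨_, ⟨p, hp, rfl⟩, ?_⟩
  rw [dist_comm, dist_eq_norm]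
  refine (Lp.norm_le_of_ae_bound hδ.le ?_).trans_lt (?_ : M * _ < ε)
  · filter_upwards [Lp.coeFn_sub (symbolLp m p)
      (BoundedContinuousFunction.toLp 2 (weightedMeasure n m) ℂ f), symbolLp_ae m p,
      BoundedContinuousFunction.coeFn_toLp 2 (weightedMeasure n m) ℂ f, ae_mem_unitBall n m]
      with z h1 h2 h3 h4
    rw [h1, Pi.sub_apply, h2, h3]
    exact hpf z h4
  · rw [mul_div_assoc', div_lt_iff₀ (by positivity)]
    nlinarith

/-- The monomials are complete in the weighted Bergman space. -/
theorem eq_zero_of_inner_monomial_eq_zero (m : ℕ) {φ : BergmanSpace n m}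
    (h : ∀ β, inner ℂ (monomial m β) φ = 0) : φ = 0 := by
  have h1 : ∀ p ∈ polynomials n, inner ℂ (incl n m φ) (symbolLp m p) = 0 := by
    intro p hp
    have hp' := polynomials_le_span_isWeight hp
    refine Submodule.span_induction
      (p := fun p _ => inner ℂ (incl n m φ) (symbolLp m p) = 0) ?_ ?_ ?_ ?_ hp'
    · rintro q ⟨-, w, hw⟩
      obtain ⟨β, c, hc⟩ := exists_proj_eq_smul_monomial m hw
      rw [inner_incl_left, hc, inner_smul_right, ← inner_conj_symm, h, map_zero, mul_zero]
    · have : symbolLp m (0 : C(Cn n, ℂ)) = 0 := MemLp.toLp_zero _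
      rw [this, inner_zero_right]
    · intro f g _ _ hf hg
      have : symbolLp m (f + g) = symbolLp m f + symbolLp m g :=
        MemLp.toLp_add (memLp_symbol m f) (memLp_symbol m g)
      rw [this, inner_add_right, hf, hg, add_zero]
    · intro c f _ hf
      have : symbolLp m (c • f) = c • symbolLp m f := MemLp.toLp_const_smul c (memLp_symbol m f)
      rw [this, inner_smul_right, hf, mul_zero]
  have h2 : incl n m φ = 0 := by
    have h3 : (fun ψ => inner ℂ (incl n m φ) ψ) = fun _ => (0 : ℂ) :=
      Continuous.ext_on (dense_symbolLp_polynomials m) (by fun_prop) continuous_const (by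
        rintro _ ⟨p, hp, rfl⟩
        exact h1 p hp)
    exact inner_self_eq_zero.1 (congrFun h3 (incl n m φ))
  exact Subtype.ext h2

end Completeness

end BergmanTriple

namespace SpectralTriple

/-! ### Operators with bounded commutators -/

section Commutators

variable {H : Type*} [NormedAddCommGroup H] [InnerProductSpace ℂ H] {D : H →ₗ.[ℂ] H}

theorem IsCommutator.add {a a' B B' : H →L[ℂ] H} (h : IsCommutator D a B)
    (h' : IsCommutator D a' B') : IsCommutator D (a + a') (B + B') := fun v => by
  obtain ⟨k, e⟩ := h v
  obtain ⟨k', e'⟩ := h' v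
  refine ⟨D.domain.add_mem k k', ?_⟩
  rw [add_apply B, ← e, ← e', ← add_sub_add_comm, ← LinearPMap.map_add]
  rfl

theorem IsCommutator.mul {a a' B B' : H →L[ℂ] H} (h : IsCommutator D a B)
    (h' : IsCommutator D a' B') : IsCommutator D (a * a') (B * a' + a * B') := fun v => by
  obtain ⟨k', e'⟩ := h' v
  obtain ⟨k, e⟩ := h ⟨_, k'⟩
  refine ⟨k, ?_⟩
  simp only [add_apply, mul_apply_eq_comp, ← e, ← e', map_sub]
  abel_nf

theorem isCommutator_algebraMap (D : H →ₗ.[ℂ] H) (c : ℂ) :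
    IsCommutator D (algebraMap ℂ (H →L[ℂ] H) c) 0 := fun v => by
  rw [Algebra.algebraMap_eq_smul_one]
  refine ⟨D.domain.smul_mem c v.2, ?_⟩
  rw [sub_eq_zero.2]
  · rfl
  · exact D.map_smul c v

/-- The algebra of the bounded operators whose commutator with `D` is bounded. -/
def commutatorSubalgebra (D : H →ₗ.[ℂ] H) : Subalgebra ℂ (H →L[ℂ] H) where
  carrier := {a | ∃ B, IsCommutator D a B}
  mul_mem' := fun ⟨_, h⟩ ⟨_, h'⟩ => ⟨_, h.mul h'⟩
  add_mem' := fun ⟨_, h⟩ ⟨_, h'⟩ => ⟨_, h.add h'⟩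
  algebraMap_mem' c := ⟨0, isCommutator_algebraMap D c⟩

end Commutators

end SpectralTriple

namespace BergmanTriple

open ComplexConjugate SpectralTriple

/-! ### Toeplitz operators and the Dirac operators -/

section Toeplitz

variable {n : ℕ}

theorem mulOp_add (m : ℕ) (f g : C(Cn n, ℂ)) (φ : Lp ℂ 2 (weightedMeasure n m)) :
    mulOp n m (f + g) φ = mulOp n m f φ + mulOp n m g φ := by
  refine Lp.ext ?_
  filter_upwards [mulOp_ae n m (f + g) φ, mulOp_ae n m f φ, mulOp_ae n m g φ,
    Lp.coeFn_add (mulOp n m f φ) (mulOp n m g φ)] with z h1 h2 h3 h4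
  rw [h1, h4, Pi.add_apply, h2, h3, ContinuousMap.add_apply, add_mul]

theorem mulOp_smul (m : ℕ) (c : ℂ) (f : C(Cn n, ℂ)) (φ : Lp ℂ 2 (weightedMeasure n m)) :
    mulOp n m (c • f) φ = c • mulOp n m f φ := by
  refine Lp.ext ?_
  filter_upwards [mulOp_ae n m (c • f) φ, mulOp_ae n m f φ,
    Lp.coeFn_smul c (mulOp n m f φ)] with z h1 h2 h3
  rw [h1, h3, Pi.smul_apply, h2, ContinuousMap.smul_apply, smul_mul_assoc]

theorem toeplitz_add (m : ℕ) (f g : C(Cn n, ℂ)) :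
    toeplitz n m (f + g) = toeplitz n m f + toeplitz n m g := by
  ext φ
  simp only [toeplitz, ContinuousLinearMap.comp_apply, add_apply, mulOp_add, map_add]

theorem toeplitz_smul (m : ℕ) (c : ℂ) (f : C(Cn n, ℂ)) :
    toeplitz n m (c • f) = c • toeplitz n m f := by
  ext φ
  simp only [toeplitz, ContinuousLinearMap.comp_apply, smul_apply, mulOp_smul, map_smul]

theorem norm_toeplitz_le (m : ℕ) {f : C(Cn n, ℂ)} {C : ℝ} (hC : 0 ≤ C)
    (hf : ∀ z ∈ unitBall n, ‖f z‖ ≤ C) : ‖toeplitz n m f‖ ≤ C := by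
  refine ContinuousLinearMap.opNorm_le_bound _ hC fun φ => ?_
  have h1 : ‖mulOp n m f (incl n m φ)‖ ≤ C * ‖incl n m φ‖ := by
    refine Lp.norm_le_mul_norm_of_ae_le_mul ?_
    filter_upwards [mulOp_ae n m f (incl n m φ), ae_mem_unitBall n m] with z h2 h3
    rw [h2, norm_mul]
    exact mul_le_mul_of_nonneg_right (hf z h3) (norm_nonneg _)
  exact ((bergman n m).norm_orthogonalProjectionOnto_apply_le _).trans h1

/-- The norms of the Toeplitz operators with a fixed symbol are bounded uniformly in the weight. -/
theorem exists_norm_toeplitz_le (f : C(Cn n, ℂ)) : ∃ C : ℝ, ∀ m, ‖toeplitz n m f‖ ≤ C := by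
  obtain ⟨C, hC⟩ := (isCompact_closedBall (0 : Cn n) 1).exists_bound_of_continuousOn
    f.continuous.continuousOn
  have hC0 : 0 ≤ C := (norm_nonneg _).trans (hC 0 (by simp))
  exact ⟨C, fun m => norm_toeplitz_le m hC0 fun z hz => hC z (Metric.ball_subset_closedBall hz)⟩

theorem monomial_ne_zero (m : ℕ) (β : Fin n → ℕ) : monomial m β ≠ 0 := by
  intro h
  have h1 : (0 : Cn n → ℂ) =ᵐ[weightedMeasure n m] monomialFun β := by
    refine Filter.EventuallyEq.trans ?_ (incl_monomial_ae m β)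
    rw [h, map_zero]
    exact (Lp.coeFn_zero _ _ _).symm
  have h2 := eqOn_unitBall_of_ae_eq (continuous_const.continuousOn)
    (monomialFun β).continuous.continuousOn h1
  -- a point of the ball with no vanishing coordinate
  set t : ℝ := (√(n + 1 : ℝ))⁻¹ with ht
  have ht0 : 0 < t := by positivity
  let z : Cn n := WithLp.toLp 2 fun _ => (t : ℂ)
  have hz : z ∈ unitBall n := by
    have h3 : ‖z‖ ^ 2 < 1 := by
      rw [EuclideanSpace.norm_sq_eq]
      simp only [z, Complex.norm_of_nonneg ht0.le, Finset.sum_const, Finset.card_univ,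
        Fintype.card_fin, nsmul_eq_mul]
      rw [ht, inv_pow, Real.sq_sqrt (by positivity), ← div_eq_mul_inv, div_lt_one (by positivity)]
      linarith
    have h4 : ‖z‖ < 1 := by nlinarith [norm_nonneg z]
    simpa [unitBall] using h4
  have h5 := h2 hz
  change (0 : ℂ) = _ at h5
  rw [monomialFun_apply, eq_comm, Finset.prod_eq_zero_iff] at h5
  obtain ⟨j, -, hj⟩ := h5
  exact pow_ne_zero _ (show (t : ℂ) ≠ 0 by exact_mod_cast ht0.ne') hj

theorem orthonormal_normalized_monomial (m : ℕ) :
    Orthonormal ℂ fun β : Fin n → ℕ => (‖monomial m β‖⁻¹ : ℂ) • monomial m β := by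
  refine ⟨fun β => ?_, fun β γ h => ?_⟩
  · rw [norm_smul, norm_inv, Complex.norm_real, norm_norm,
      inv_mul_cancel₀ (norm_ne_zero_iff.2 (monomial_ne_zero m β))]
  · dsimp only
    rw [inner_smul_left, inner_smul_right, inner_monomial_eq_zero m h.symm, mul_zero, mul_zero]

/-- The Hilbert basis of normalized monomials of the weighted Bergman space. -/
def monomialBasis (n m : ℕ) : HilbertBasis (Fin n → ℕ) ℂ (BergmanSpace n m) :=
  HilbertBasis.mkOfOrthogonalEqBot (v := fun β => (‖monomial m β‖⁻¹ : ℂ) • monomial m β)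
    (orthonormal_normalized_monomial m)
    (by
      rw [Submodule.eq_bot_iff]
      intro φ hφ
      refine eq_zero_of_inner_monomial_eq_zero m fun β => ?_
      have h := (Submodule.mem_orthogonal _ _).1 hφ _ (Submodule.subset_span ⟨β, rfl⟩)
      rw [inner_smul_left, mul_eq_zero] at h
      refine h.resolve_left ?_
      simpa using monomial_ne_zero m β)

theorem monomialBasis_apply (m : ℕ) (β : Fin n → ℕ) :
    monomialBasis n m β = (‖monomial m β‖⁻¹ : ℂ) • monomial m β := by
  rw [monomialBasis, HilbertBasis.coe_mkOfOrthogonalEqBot]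

theorem inner_monomialBasis_toeplitz (m : ℕ) (f : C(Cn n, ℂ)) (β γ : Fin n → ℕ) :
    inner ℂ (monomialBasis n m γ) (toeplitz n m f (monomialBasis n m β))
      = (‖monomial m γ‖⁻¹ : ℂ) * (‖monomial m β‖⁻¹ : ℂ) *
        inner ℂ (monomial m γ) (toeplitz n m f (monomial m β)) := by
  rw [monomialBasis_apply, monomialBasis_apply, map_smul, inner_smul_left, inner_smul_right,
    map_inv₀, Complex.conj_ofReal]
  ring

theorem inner_monomialBasis_toeplitz_eq_zero (m : ℕ) {f : C(Cn n, ℂ)} {w : Fin n → ℤ}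
    (hf : IsWeight w f) {β γ : Fin n → ℕ}
    (h : w + (fun j => (β j : ℤ)) ≠ fun j => (γ j : ℤ)) :
    inner ℂ (monomialBasis n m γ) (toeplitz n m f (monomialBasis n m β)) = 0 := by
  rw [inner_monomialBasis_toeplitz, inner_monomial_toeplitz_eq_zero m hf h, mul_zero]

/-- The eigenvalue of `T_{-r}` on `z^β`. -/
def toeplitzEigenvalue (n m : ℕ) (β : Fin n → ℕ) : ℝ :=
  (m + 1) / (n + m + 1 + (∑ j, β j : ℕ))

theorem toeplitzEigenvalue_pos (n m : ℕ) (β : Fin n → ℕ) : 0 < toeplitzEigenvalue n m β := by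
  unfold toeplitzEigenvalue
  positivity

theorem neg_defFun_apply (z : Cn n) : (-defFun n) z = ((1 - ‖z‖ ^ 2 : ℝ) : ℂ) := by
  rw [ContinuousMap.neg_apply]
  change -((‖z‖ ^ 2 - 1 : ℝ) : ℂ) = _
  push_cast
  ring

theorem isWeight_neg_defFun : IsWeight 0 (-defFun n) := fun u z => by
  rw [neg_defFun_apply, neg_defFun_apply, LinearIsometryEquiv.norm_map]
  simp [torusChar]

theorem inner_monomial_toeplitz_neg_defFun (hn : 1 ≤ n) (m : ℕ) (β : Fin n → ℕ) :
    inner ℂ (monomial m β) (toeplitz n m (-defFun n) (monomial m β))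
      = toeplitzEigenvalue n m β * (‖monomial m β‖ : ℂ) ^ 2 := by
  have h1 : inner ℂ (monomial m β) (toeplitz n m (-defFun n) (monomial m β))
      = ((∫ z, (1 - ‖z‖ ^ 2) * ‖monomialFun β z‖ ^ 2 ∂weightedMeasure n m : ℝ) : ℂ) := by
    rw [inner_monomial_toeplitz, ← integral_complex_ofReal]
    refine integral_congr_ae (.of_forall fun z => ?_)
    dsimp only
    rw [mul_assoc, Complex.mul_conj', neg_defFun_apply]
    push_cast
    rfl
  have h2 := integral_norm_monomial_succ hn m β
  have h3 : ((n : ℝ) + m + 1 + (∑ j, β j : ℕ)) ≠ 0 := by positivity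
  rw [h1, norm_monomial_sq, ← Complex.ofReal_mul]
  congr 1
  rw [toeplitzEigenvalue, div_mul_eq_mul_div, ← h2, mul_div_cancel_left₀ _ h3]

theorem toeplitz_neg_defFun_monomialBasis (hn : 1 ≤ n) (m : ℕ) (β : Fin n → ℕ) :
    toeplitz n m (-defFun n) (monomialBasis n m β)
      = (toeplitzEigenvalue n m β : ℂ) • monomialBasis n m β := by
  refine (monomialBasis n m).ext_inner fun γ => ?_
  rw [inner_smul_right]
  rcases eq_or_ne γ β with rfl | h
  · have h0 : (‖monomial m γ‖ : ℂ) ≠ 0 := by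
      exact_mod_cast norm_ne_zero_iff.2 (monomial_ne_zero m γ)
    rw [HilbertBasis.inner_self_eq_one, inner_monomialBasis_toeplitz,
      inner_monomial_toeplitz_neg_defFun hn]
    field_simp
  · rw [HilbertBasis.inner_eq_zero_of_ne _ h, mul_zero,
      inner_monomialBasis_toeplitz_eq_zero m isWeight_neg_defFun]
    rw [zero_add]
    exact fun h' => h (funext fun j => by exact_mod_cast (congrFun h' j).symm)

/-- The operator `D_m` is diagonal in the basis of monomials. -/
theorem isDiagonal_dirac (hn : 1 ≤ n) (m : ℕ) :
    IsDiagonal (dirac n m) (monomialBasis n m) fun β => (toeplitzEigenvalue n m β)⁻¹ := by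
  refine IsDiagonal.of_inverse (fun β => (toeplitzEigenvalue_pos n m β).ne') fun φ β => ?_
  have h1 : star (-defFun n) = -defFun n := by
    ext z
    rw [ContinuousMap.star_apply, neg_defFun_apply]
    exact Complex.conj_ofReal _
  have h2 := star_toeplitz n m (-defFun n)
  rw [h1, ContinuousLinearMap.star_eq_adjoint] at h2
  rw [← h2, ContinuousLinearMap.adjoint_inner_right, toeplitz_neg_defFun_monomialBasis hn,
    inner_smul_left, Complex.conj_ofReal]

theorem weight_mul_eigenvalue (n m : ℕ) (β : Fin n → ℕ) :
    weight m * (toeplitzEigenvalue n m β)⁻¹ = n + 1 + (m + ∑ j, β j : ℕ) := by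
  have h1 : (m : ℝ) + 1 ≠ 0 := by positivity
  rw [weight, toeplitzEigenvalue, inv_div, mul_div_cancel₀ _ h1]
  push_cast
  ring

theorem weight_pos (m : ℕ) : 0 < weight m := by
  unfold weight
  positivity

theorem isDiagonal_weight_smul_dirac (hn : 1 ≤ n) (m : ℕ) :
    IsDiagonal ((weight m : ℂ) • dirac n m) (monomialBasis n m)
      fun β => (n : ℝ) + 1 + (m + ∑ j, β j : ℕ) := by
  simpa only [weight_mul_eigenvalue] using (isDiagonal_dirac hn m).smul (weight_pos m).ne'

/-- The commutator of `α_m D_m` with the Toeplitz operator of a polynomial is the Toeplitz operator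
of a symbol which does not depend on `m`: the degree operator acts as a derivation on symbols. -/
theorem exists_isCommutator_toeplitz (hn : 1 ≤ n) {p : C(Cn n, ℂ)} (hp : p ∈ polynomials n) :
    ∃ q : C(Cn n, ℂ), ∀ m, IsCommutator ((weight m : ℂ) • dirac n m) (toeplitz n m p)
      (toeplitz n m q) := by
  have hp' := polynomials_le_span_isWeight hp
  suffices h : ∃ q : C(Cn n, ℂ), ∀ m (γ β : Fin n → ℕ),
      inner ℂ (monomialBasis n m γ) (toeplitz n m q (monomialBasis n m β))
        = ((∑ j, γ j : ℕ) - (∑ j, β j : ℕ) : ℂ)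
          * inner ℂ (monomialBasis n m γ) (toeplitz n m p (monomialBasis n m β)) by
    obtain ⟨q, hq⟩ := h
    refine ⟨q, fun m => (isDiagonal_weight_smul_dirac hn m).isCommutator fun γ β => ?_⟩
    rw [hq]
    push_cast
    ring
  refine Submodule.span_induction (p := fun p _ => ∃ q : C(Cn n, ℂ), ∀ m (γ β : Fin n → ℕ),
      inner ℂ (monomialBasis n m γ) (toeplitz n m q (monomialBasis n m β))
        = ((∑ j, γ j : ℕ) - (∑ j, β j : ℕ) : ℂ)
          * inner ℂ (monomialBasis n m γ) (toeplitz n m p (monomialBasis n m β))) ?_ ?_ ?_ ?_ hp'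
  · rintro f ⟨-, w, hw⟩
    refine ⟨(∑ j, w j : ℂ) • f, fun m γ β => ?_⟩
    rw [toeplitz_smul, smul_apply, inner_smul_right]
    by_cases h : w + (fun j => (β j : ℤ)) = fun j => (γ j : ℤ)
    · have h1 : ∀ j, (w j : ℂ) = γ j - β j := fun j => by
        have : w j + β j = γ j := congrFun h j
        rw [eq_sub_iff_add_eq]
        exact_mod_cast this
      simp only [h1, Finset.sum_sub_distrib]
      push_cast
      rfl
    · rw [inner_monomialBasis_toeplitz_eq_zero m hw h, mul_zero, mul_zero]
  · refine ⟨0, fun m γ β => ?_⟩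
    have h0 : toeplitz n m (0 : C(Cn n, ℂ)) = 0 := by
      rw [← zero_smul ℂ (0 : C(Cn n, ℂ)), toeplitz_smul, zero_smul]
    rw [h0]
    simp
  · rintro f g _ _ ⟨q, hq⟩ ⟨q', hq'⟩
    refine ⟨q + q', fun m γ β => ?_⟩
    rw [toeplitz_add, toeplitz_add, add_apply, add_apply, inner_add_right, inner_add_right, hq, hq']
    ring
  · rintro c f _ ⟨q, hq⟩
    refine ⟨c • q, fun m γ β => ?_⟩
    rw [toeplitz_smul, toeplitz_smul, smul_apply, smul_apply, inner_smul_right, inner_smul_right,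
      hq]
    ring

theorem exists_isCommutator_rep (hn : 1 ≤ n) (m : ℕ) (a : toeplitzAlgebra n m) :
    ∃ B, IsCommutator (dirac n m) (rep n m a) B := by
  have hgen : ∀ p ∈ polynomials n, toeplitz n m p ∈ commutatorSubalgebra (dirac n m) := by
    intro p hp
    obtain ⟨q, hq⟩ := exists_isCommutator_toeplitz hn hp
    refine ⟨((weight m)⁻¹ : ℂ) • toeplitz n m q,
      (isDiagonal_dirac hn m).isCommutator fun γ β => ?_⟩
    have h0 : (weight m : ℂ) ≠ 0 := by exact_mod_cast (weight_pos m).ne'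
    have h1 := ((isDiagonal_dirac hn m).smul (weight_pos m).ne').inner_commutator (hq m) γ β
    rw [smul_apply, inner_smul_right, h1, inv_mul_eq_iff_eq_mul₀ h0]
    push_cast
    ring
  have hle : (toeplitzAlgebra n m).toSubalgebra ≤ commutatorSubalgebra (dirac n m) := by
    rw [toeplitzAlgebra, StarAlgebra.adjoin_toSubalgebra]
    refine Algebra.adjoin_le (Set.union_subset ?_ ?_)
    · rintro _ ⟨p, hp, rfl⟩
      exact hgen p hp
    · rintro T ⟨p, hp, hT⟩
      rw [← star_star T, hT, star_toeplitz]
      exact hgen _ (star_mem hp)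
  exact hle a.2

theorem isSpectralTriple_rep (hn : 1 ≤ n) (m : ℕ) : IsSpectralTriple (rep n m) (dirac n m) where
  faithful := Subtype.val_injective
  selfAdjoint := (isDiagonal_dirac hn m).isSelfAdjoint
  compact_resolvent _ _ hR := by
    refine (isDiagonal_dirac hn m).isCompactOperator_of_isResolventAt ?_ hR
    have h1 := (tendsto_eigenvalue_cofinite n).comp
      (sigma_mk_injective (β := fun _ : ℕ => Fin n → ℕ) (i := m)).tendsto_cofinite
    refine (h1.const_mul_atTop (inv_pos.2 (weight_pos m))).congr fun β => ?_
    simp only [Function.comp_apply]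
    rw [← weight_mul_eigenvalue, abs_mul, abs_of_pos (weight_pos m),
      inv_mul_cancel_left₀ (weight_pos m).ne']
  commutator := exists_isCommutator_rep hn m

theorem isIntegrable_dirac (hn : 1 ≤ n) : IsIntegrable (rep n) (dirac n) weight where
  spectralTriple := isSpectralTriple_rep hn
  weight_ne_zero m := (weight_pos m).ne'
  tendsto_zero := by
    have h1 : ∀ m, ∃ B, IsInvSqrtOneAddSq ((weight m : ℂ) • dirac n m) B ∧ ‖B‖ ≤ (weight m)⁻¹ :=
      fun m => (isDiagonal_weight_smul_dirac hn m).exists_isInvSqrtOneAddSq (weight_pos m)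
        fun β => by
          rw [weight]
          push_cast
          have : (0 : ℝ) ≤ ∑ j, (β j : ℝ) := Finset.sum_nonneg fun _ _ => Nat.cast_nonneg _
          linarith [(Nat.cast_nonneg n : (0 : ℝ) ≤ n)]
    choose B hB hBn using h1
    refine ⟨B, hB, squeeze_zero (fun m => norm_nonneg _) hBn ?_⟩
    simpa only [weight, one_div] using tendsto_one_div_add_atTop_nhds_zero_nat (𝕜 := ℝ)

theorem isDiagonal_sumDirac (hn : 1 ≤ n) :
    IsDiagonal (sumDirac n) (sumBasis (monomialBasis n))
      fun p => (n : ℝ) + 1 + (p.1 + ∑ j, p.2 j : ℕ) := by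
  have h := isDiagonal_closure_sumOp (α := weight) (isDiagonal_dirac hn)
  simp only [weight_mul_eigenvalue] at h
  exact h

theorem constAlgebra_le_sumAlgebra (hn : 1 ≤ n) (hI : IsIntegrable (rep n) (dirac n) weight) :
    constAlgebra n ≤ sumAlgebra hI := by
  have h : Algebra.adjoin ℂ (constSequences n) ≤ (sumAlgebra hI).toSubalgebra := by
    refine Algebra.adjoin_le ?_
    rintro a ⟨p, hp, ha⟩
    obtain ⟨C, hC⟩ := exists_norm_toeplitz_le p
    obtain ⟨q, hq⟩ := exists_isCommutator_toeplitz hn hp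
    obtain ⟨C', hC'⟩ := exists_norm_toeplitz_le q
    have ha' : ∀ m, rep n m (a m) = toeplitz n m p := ha
    exact ⟨⟨C, fun m => by rw [ha']; exact hC m⟩,
      C', fun m => ⟨toeplitz n m q, by rw [ha']; exact hq m, hC' m⟩⟩
  exact h

/-- The trace of `|D|⁻ˢ` is finite exactly for `s > n + 1`. -/
theorem isSpectralDimension_sumDirac (hn : 1 ≤ n) : IsSpectralDimension (sumDirac n) (n + 1) := by
  have h : {s : ℝ | traceAbsPow (sumDirac n) s < ∞} = Set.Ioi ((n : ℝ) + 1) := by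
    ext s
    rw [Set.mem_ofPred_eq, (isDiagonal_sumDirac hn).traceAbsPow_eq, tsum_rpow_lt_top_iff,
      Set.mem_Ioi]
  rw [IsSpectralDimension, h]
  exact isGLB_Ioi

end Toeplitz

end BergmanTriple

end

theorem mainTheorem3 (n : ℕ) (hn : 1 ≤ n) :
    ∃ hI : SpectralTriple.IsIntegrable (BergmanTriple.rep n) (BergmanTriple.dirac n)
        BergmanTriple.weight,
      SpectralTriple.IsSpectralTriple (SpectralTriple.sumRep hI) (BergmanTriple.sumDirac n) ∧
      ∃ hsub : BergmanTriple.constAlgebra n ≤ SpectralTriple.sumAlgebra hI,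
        SpectralTriple.IsSpectralTriple (SpectralTriple.subRep hI hsub)
          (BergmanTriple.sumDirac n) ∧
        SpectralTriple.IsSpectralDimension (BergmanTriple.sumDirac n) (n + 1) := by
  have hI := BergmanTriple.isIntegrable_dirac hn
  have hsub := BergmanTriple.constAlgebra_le_sumAlgebra hn hI
  have hT := SpectralTriple.isSpectralTriple_sumRep hI (BergmanTriple.isDiagonal_dirac hn) (by
    simpa only [BergmanTriple.weight_mul_eigenvalue] using
      SpectralTriple.tendsto_eigenvalue_cofinite n)
  exact ⟨hI, hT, hsub, SpectralTriple.isSpectralTriple_subRep hI hT hsub,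
    BergmanTriple.isSpectralDimension_sumDirac hn⟩
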